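/- Let $0<\lambda_1<\lambda_2<\cdots<\lambda_n$ be real numbers and let $G_{n,m}(\mathbb{R})=M/GL(m,\mathbb{R})$ be the Grassmann manifold of $m$-dimensional subspaces of $\mathbb{R}^n$, where $M$ is the set of real $m\times n$ matrices $X=(x_{\alpha j})$ of rank $m$ and $\pi:M\to G_{n,m}(\mathbb{R})$ is the projection. For a multi-index $I=(i_1<\cdots<i_m)$ in $\{1,\dots,n\}$ let $U_I\subset M$ be the set of matrices whose columns $i_1,\dots,i_m$ form the identity matrix, and let $\widetilde U_I=\pi(U_I)$, with coordinates $Z=(x_{\alpha j})_{1\le\alpha\le m,\ j\notin I}$. Let $O_I\in\widetilde U_I$ be the point with all coordinates $0$. Let $f:G_{n,m}(\mathbb{R})\to\mathbb{R}$ be $$f(\pi(X))=\frac{\det\big(\sum_{j=1}^n x_{\alpha j}x_{\beta j}\big)_{\alpha,\beta}}{\det\big(\sum_{j=1}^n \lambda_j^{-2}x_{\alpha j}x_{\beta j}\big)_{\alpha,\beta}},$$ and let $g$ be the Riemannian metric given in each chart $\widetilde U_I$ by $g=\mathrm{tr}\big[(I_m+ZZ^T)^{-1}dZ\,(I_{n-m}+Z^TZ)^{-1}dZ^T\big]$.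 For a critical point $p$ of $f$ let $W^u(p)$ (resp. $W^s(p)$) be the set of points $x$ such that the solution $\varphi:\mathbb{R}\to G_{n,m}(\mathbb{R})$ of $\dot\varphi=-\nabla f(\varphi)$ with $\varphi(0)=x$ tends to $p$ as $t\to-\infty$ (resp. $t\to+\infty$). Let $O_I$ and $O_L$ be critical points of $f$ with Morse indices satisfying $\mathrm{ind}(O_I)-\mathrm{ind}(O_L)=1$, where $L=(i_1,\dots,i_k-1,\dots,i_m)$ is obtained from $I=(i_1,\dots,i_m)$ by lowering the $k$-th entry by $1$ (and is again strictly increasing with entries in $\{1,\dots,n\}$). Then $$W^u(O_{i_1\cdots i_m})\cap W^s(O_{i_1\cdots(i_k-1)\cdots i_m})=\{p\in\widetilde U_{i_1\cdots i_m}\;:\;x_{k(i_k-1)}(p)\neq0,\ x_{\alpha j}(p)=0\text{ for all }j\notin I,\ (\alpha,j)\neq(k,i_k-1)\}.$$ -/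

import Mathlib

open Filter Topology

namespace RealGrassmann

/-- Real `m × n` matrices of rank `m`. -/
abbrev FullRank (m n : ℕ) : Type :=
  {X : Matrix (Fin m) (Fin n) ℝ // X.rank = m}

/-- Two matrices of rank `m` have the same row space iff they differ by the left action of
`GL(m, ℝ)`. -/
def rowEquiv (m n : ℕ) : Setoid (FullRank m n) where
  r X Y := ∃ A : GL (Fin m) ℝ, Y.1 = (A : Matrix (Fin m) (Fin m) ℝ) * X.1
  iseqv :=
    { refl := fun X => ⟨1, by simp⟩
      symm := by
        rintro X Y ⟨A, h⟩
        refine ⟨A⁻¹, ?_⟩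
        rw [h, ← Matrix.mul_assoc, ← Units.val_mul]
        simp
      trans := by
        rintro X Y W ⟨A, h⟩ ⟨B, h'⟩
        refine ⟨B * A, ?_⟩
        rw [h', h, ← Matrix.mul_assoc, ← Units.val_mul] }

/-- The Grassmann manifold of `m`-dimensional subspaces of `ℝⁿ`, as the quotient of the matrices
of rank `m` by `GL(m, ℝ)`. -/
def Gr (m n : ℕ) : Type := Quotient (rowEquiv m n)

/-- The quotient topology. -/
instance (m n : ℕ) : TopologicalSpace (Gr m n) :=
  inferInstanceAs (TopologicalSpace (Quotient (rowEquiv m n)))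

/-- The projection from matrices of rank `m` to the Grassmann manifold. -/
def proj {m n : ℕ} (X : FullRank m n) : Gr m n := Quotient.mk (rowEquiv m n) X

/-- The matrix of the inner products `⟨ξ_α, ξ_β⟩` of the rows of `X`. -/
def gram {m n : ℕ} (X : Matrix (Fin m) (Fin n) ℝ) : Matrix (Fin m) (Fin m) ℝ :=
  Matrix.of fun α β => ∑ j, X α j * X β j

/-- The matrix with rows `(x_{α1} / λ₁, …, x_{αn} / λₙ)`. -/
noncomputable def rescale {m n : ℕ} (lam : Fin n → ℝ) (X : Matrix (Fin m) (Fin n) ℝ) :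
    Matrix (Fin m) (Fin n) ℝ :=
  Matrix.of fun α j => X α j / lam j

theorem gram_eq {m n : ℕ} (X : Matrix (Fin m) (Fin n) ℝ) : gram X = X * X.transpose := by
  ext α β
  simp [gram, Matrix.mul_apply]

theorem rescale_mul {m n : ℕ} (lam : Fin n → ℝ) (A : Matrix (Fin m) (Fin m) ℝ)
    (X : Matrix (Fin m) (Fin n) ℝ) : rescale lam (A * X) = A * rescale lam X := by
  ext α j
  simp [rescale, Matrix.mul_apply, Finset.sum_div, mul_div_assoc]

theorem det_gram_mul {m n : ℕ} (A : Matrix (Fin m) (Fin m) ℝ) (X : Matrix (Fin m) (Fin n) ℝ) :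
    (gram (A * X)).det = A.det * A.det * (gram X).det := by
  rw [gram_eq, gram_eq, Matrix.transpose_mul, Matrix.mul_assoc, ← Matrix.mul_assoc X,
    Matrix.det_mul, Matrix.det_mul, Matrix.det_transpose]
  ring

/-- The function `f = Δ / Δ̄` on the Grassmann manifold, the quotient of the Gram determinants of
the rows and of the rescaled rows of any representing matrix. -/
noncomputable def f {m n : ℕ} (lam : Fin n → ℝ) : Gr m n → ℝ :=
  Quotient.lift
    (fun X : FullRank m n => (gram X.1).det / (gram (rescale lam X.1)).det)
    (by
      rintro X Y ⟨A, h⟩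
      have hA : (A : Matrix (Fin m) (Fin m) ℝ).det ≠ 0 :=
        ((Matrix.isUnit_iff_isUnit_det _).1 A.isUnit).ne_zero
      simp only [h, rescale_mul, det_gram_mul]
      rw [mul_div_mul_left _ _ (mul_ne_zero hA hA)])

/-- The column indices outside the multi-index `i₁ < ⋯ < i_m`. -/
abbrev Free {m n : ℕ} (I : Fin m ↪o Fin n) : Type := {j : Fin n // ∀ α, I α ≠ j}

/-- The coordinate space `ℝ^{m(n-m)}` of the chart of `I`, with coordinates `x_{αj}`, `j ∉ I`. -/
abbrev Coord {m n : ℕ} (I : Fin m ↪o Fin n) : Type := Fin m → Free I → ℝ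

/-- The set `U_I` of matrices whose columns `i₁, …, i_m` form the identity matrix. -/
def U {m n : ℕ} (I : Fin m ↪o Fin n) : Set (FullRank m n) :=
  {X | X.1.submatrix id I = 1}

/-- The chart domain, the image of `U_I` in the Grassmann manifold. -/
def chartDomain {m n : ℕ} (I : Fin m ↪o Fin n) : Set (Gr m n) := proj '' U I

/-- The matrix whose columns `i₁, …, i_m` form the identity matrix and whose other entries are
given by `Z`. -/
def chartMatrix {m n : ℕ} (I : Fin m ↪o Fin n) (Z : Coord I) : Matrix (Fin m) (Fin n) ℝ :=
  Matrix.of fun α j =>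
    if h : ∀ β, I β ≠ j then Z α ⟨j, h⟩ else if I α = j then 1 else 0

theorem chartMatrix_submatrix {m n : ℕ} (I : Fin m ↪o Fin n) (Z : Coord I) :
    (chartMatrix I Z).submatrix id I = 1 := by
  ext α β
  have h : ¬ ∀ γ, I γ ≠ I β := fun h => h β rfl
  simp [chartMatrix, Matrix.one_apply]

theorem chartMatrix_rank {m n : ℕ} (I : Fin m ↪o Fin n) (Z : Coord I) :
    (chartMatrix I Z).rank = m := by
  apply le_antisymm
  · simpa using Matrix.rank_le_card_height (chartMatrix I Z)
  · have h : chartMatrix I Z * (1 : Matrix (Fin n) (Fin n) ℝ).submatrix id I = 1 := by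
      rw [← chartMatrix_submatrix I Z]
      ext α β
      simp [Matrix.mul_apply, Matrix.one_apply]
    have h2 := Matrix.rank_mul_le_left (chartMatrix I Z)
      ((1 : Matrix (Fin n) (Fin n) ℝ).submatrix id I)
    rw [h, Matrix.rank_one] at h2
    simpa using h2

/-- The inverse of the coordinate map of the chart of `I`: the point with coordinates `Z`. -/
def chartPoint {m n : ℕ} (I : Fin m ↪o Fin n) (Z : Coord I) : Gr m n :=
  proj ⟨chartMatrix I Z, chartMatrix_rank I Z⟩

/-- The critical point `O_I`, the origin of the chart of `I`. -/
def O {m n : ℕ} (I : Fin m ↪o Fin n) : Gr m n := chartPoint I 0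

/-- The Morse index of `f` at a critical point `p`: the largest dimension of a subspace on which
the Hessian of `f` at `p`, read in a chart around `p`, is negative definite. -/
noncomputable def morseIndex {m n : ℕ} (lam : Fin n → ℝ) (p : Gr m n) : ℕ :=
  sSup {d | ∃ (I : Fin m ↪o Fin n) (Z : Coord I) (E : Submodule ℝ (Coord I)),
    chartPoint I Z = p ∧ Module.finrank ℝ E = d ∧
      ∀ v ∈ E, v ≠ 0 →
        iteratedDeriv 2 (fun s : ℝ => f lam (chartPoint I (Z + s • v))) 0 < 0}

/-- The Riemannian metric `g = tr[(I + Z Zᵀ)⁻¹ dZ (I + Zᵀ Z)⁻¹ dZᵀ]` in the chart of `I`, at the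
point with coordinates `Z`. -/
noncomputable def metric {m n : ℕ} (I : Fin m ↪o Fin n) (Z V W : Coord I) : ℝ :=
  ((1 + Matrix.of Z * (Matrix.of Z).transpose)⁻¹ * Matrix.of V *
    (1 + (Matrix.of Z).transpose * Matrix.of Z)⁻¹ * (Matrix.of W).transpose).trace

/-- `V` is the coordinate vector of `∇ f` at the point with coordinates `Z` in the chart of `I`:
`g(V, W) = df(W)` for all `W`. -/
def IsGradient {m n : ℕ} (lam : Fin n → ℝ) (I : Fin m ↪o Fin n) (Z V : Coord I) : Prop :=
  ∀ W : Coord I, metric I Z V W = fderiv ℝ (fun Y : Coord I => f lam (chartPoint I Y)) Z W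

/-- `γ` is a solution of `ẋ = -∇ f` on the whole real line: at every time, and in every chart
around the current point, its coordinate expression `z` has derivative `-∇ f`. -/
def IsFlowLine {m n : ℕ} (lam : Fin n → ℝ) (γ : ℝ → Gr m n) : Prop :=
  ∀ (t : ℝ) (I : Fin m ↪o Fin n), γ t ∈ chartDomain I →
    ∃ (z : ℝ → Coord I) (V : Coord I), (∀ᶠ s in 𝓝 t, γ s = chartPoint I (z s)) ∧
      IsGradient lam I (z t) V ∧ HasDerivAt z (-V) t

/-- The stable manifold of `p`: the points whose flow line tends to `p` as `t → +∞`. -/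
def Ws {m n : ℕ} (lam : Fin n → ℝ) (p : Gr m n) : Set (Gr m n) :=
  {x | ∃ γ : ℝ → Gr m n, IsFlowLine lam γ ∧ γ 0 = x ∧ Tendsto γ atTop (𝓝 p)}

/-- The unstable manifold of `p`: the points whose flow line tends to `p` as `t → -∞`. -/
def Wu {m n : ℕ} (lam : Fin n → ℝ) (p : Gr m n) : Set (Gr m n) :=
  {x | ∃ γ : ℝ → Gr m n, IsFlowLine lam γ ∧ γ 0 = x ∧ Tendsto γ atBot (𝓝 p)}

/-- The set of points of the chart domain of `I` whose coordinate `x_{kj}` is nonzero and whose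
other coordinates all vanish. -/
def puncturedAxis {m n : ℕ} (I : Fin m ↪o Fin n) (k : Fin m) (j : Fin n) : Set (Gr m n) :=
  proj '' {X | X ∈ U I ∧ X.1 k j ≠ 0 ∧
    ∀ (α : Fin m) (l : Free I), (α, (l : Fin n)) ≠ (k, j) → X.1 α l = 0}

end RealGrassmann

/-! Let `P` be the orthogonal projection onto the row space and call its diagonal entry `w_l = P_ll`
the weight of `l`. It is 0 when the `l`-th column vanishes and 1 when the basis vector `e_l` lies in
the subspace; `O_I` has weight 1 on `I` and 0 off it. With `D = diag(λ_j⁻²)`, `S = X D Xᵀ` and `q_l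
= x_lᵀ S⁻¹ x_l`, where `x_l` is the `l`-th column of `X`, the flow of `-∇f` gives `w_l' = 4 f (λ_l⁻²
q_l - w_l)` (`hasDerivAt_weight`).

By Cauchy–Schwarz, `w_l` is nondecreasing while all weights of smaller index are 0 or 1, and
nonincreasing while all weights of larger index are 0 or 1. The endpoints `O_I` and `O_L` have equal
weights outside the adjacent pair `L k`, `I k`. Induction upward from the smallest index and
downward from the largest therefore freezes every other weight at 0 or 1
(`weight_eq_of_connecting`). This puts the point on the coordinate axis joining `O_I` to `O_L`. A
Grönwall estimate shows that a vanishing weight stays zero in both time directions, so the two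
exchanged weights are nonzero and the endpoints are excluded.

Conversely, the gradient is tangent to that axis and the flow there is a scalar equation. In the
variable `log x²` its speed is bounded and positive, which gives a global solution running from
`O_I` to `O_L`; near `O_L` the curve is read in the chart of `L` through `x ↦ x⁻¹`
(`chartPoint_axis_mem_Wu_inter_Ws`). -/

namespace RealGrassmann

open Matrix

/-! ### Entrywise calculus of matrix-valued curves. -/

section Calculus

variable {p q r : Type*}

/-- Entrywise differentiability of a matrix-valued curve. -/
def HasMatrixDerivAt (A : ℝ → Matrix p q ℝ) (A' : Matrix p q ℝ) (t : ℝ) : Prop :=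
  ∀ i j, HasDerivAt (fun s => A s i j) (A' i j) t

theorem HasMatrixDerivAt.transpose {A : ℝ → Matrix p q ℝ} {A' : Matrix p q ℝ} {t : ℝ}
    (hA : HasMatrixDerivAt A A' t) : HasMatrixDerivAt (fun s => (A s)ᵀ) A'ᵀ t :=
  fun i j => hA j i

theorem HasMatrixDerivAt.unique {A : ℝ → Matrix p q ℝ} {A' A'' : Matrix p q ℝ} {t : ℝ}
    (h : HasMatrixDerivAt A A' t) (h' : HasMatrixDerivAt A A'' t) : A' = A'' := by
  ext i j
  exact (h i j).unique (h' i j)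

theorem HasMatrixDerivAt.mul [Fintype q] {A : ℝ → Matrix p q ℝ} {A' : Matrix p q ℝ}
    {B : ℝ → Matrix q r ℝ} {B' : Matrix q r ℝ} {t : ℝ} (hA : HasMatrixDerivAt A A' t) (hB : HasMatrixDerivAt B B' t) :
    HasMatrixDerivAt (fun s => A s * B s) (A' * B t + A t * B') t := by
  intro i j
  simp only [mul_apply, Matrix.add_apply, ← Finset.sum_add_distrib]
  exact HasDerivAt.fun_sum fun l _ => (hA i l).fun_mul (hB l j)

theorem HasMatrixDerivAt.mul_const [Fintype q] {A : ℝ → Matrix p q ℝ} {A' : Matrix p q ℝ} {t : ℝ}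
    (hA : HasMatrixDerivAt A A' t) (B : Matrix q r ℝ) :
    HasMatrixDerivAt (fun s => A s * B) (A' * B) t := by
  have hB : HasMatrixDerivAt (fun _ => B) 0 t := fun i j => hasDerivAt_const t (B i j)
  simpa using hA.mul hB

/-- Jacobi's formula: the determinant is multilinear in the rows, and replacing one row by its
derivative pairs that derivative with cofactors. -/
theorem HasMatrixDerivAt.det [Fintype p] [DecidableEq p] {A : ℝ → Matrix p p ℝ}
    {A' : Matrix p p ℝ} {t : ℝ} (hA : HasMatrixDerivAt A A' t) :
    HasDerivAt (fun s => (A s).det) ((adjugate (A t) * A').trace) t := by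
  let F : ContinuousMultilinearMap ℝ (fun _ : p => p → ℝ) ℝ :=
    { (detRowAlternating (n := p) (R := ℝ)).toMultilinearMap with
      cont := (continuous_id.matrix_det : Continuous fun M : Matrix p p ℝ => M.det) }
  have h1 : HasDerivAt (fun s => (fun i j => A s i j : p → p → ℝ)) (fun i j => A' i j) t := by
    rw [hasDerivAt_pi]
    intro i
    rw [hasDerivAt_pi]
    exact hA i
  have h2 := (F.hasFDerivAt (fun i j => A t i j)).comp_hasDerivAt t h1
  rw [ContinuousMultilinearMap.linearDeriv_apply] at h2
  refine h2.congr_deriv ?_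
  simp only [trace, diag, mul_apply]
  rw [Finset.sum_comm]
  refine Finset.sum_congr rfl fun i _ => ?_
  have h3 : F (Function.update (fun i j => A t i j) i (fun j => A' i j)) =
      ((A t).updateRow i (A' i)).det := rfl
  rw [h3, ← cramer_transpose_apply, cramer_eq_adjugate_mulVec, ← adjugate_transpose]
  rfl

/-- The cofactor formula gives differentiability of each entry; the value of the derivative then
follows by differentiating `A A⁻¹ = 1`. -/
theorem HasMatrixDerivAt.inv [Fintype p] [DecidableEq p] {A : ℝ → Matrix p p ℝ}
    {A' : Matrix p p ℝ} {t : ℝ} (hA : HasMatrixDerivAt A A' t) (hdet : (A t).det ≠ 0) :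
    HasMatrixDerivAt (fun s => (A s)⁻¹) (-((A t)⁻¹ * A' * (A t)⁻¹)) t := by
  have hdiff : ∀ i j, DifferentiableAt ℝ (fun s => (A s)⁻¹ i j) t := by
    intro i j
    have h1 : HasMatrixDerivAt (fun s => (A s).updateRow j (Pi.single i 1)) (A'.updateRow j 0) t := by
      intro a b
      by_cases h : a = j
      · subst h
        simpa using hasDerivAt_const t _
      · simpa [h] using hA a b
    have h2 : (fun s => (A s)⁻¹ i j) =
        fun s => ((A s).det)⁻¹ * ((A s).updateRow j (Pi.single i 1)).det := by
      ext s
      rw [inv_def, Matrix.smul_apply, adjugate_apply, Ring.inverse_eq_inv', smul_eq_mul]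
    rw [h2]
    exact (hA.det.differentiableAt.inv hdet).mul h1.det.differentiableAt
  have hB : HasMatrixDerivAt (fun s => (A s)⁻¹) (of fun i j => deriv (fun s => (A s)⁻¹ i j) t) t :=
    fun i j => (hdiff i j).hasDerivAt
  set B' : Matrix p p ℝ := of fun i j => deriv (fun s => (A s)⁻¹ i j) t
  have hev : ∀ᶠ s in 𝓝 t, A s * (A s)⁻¹ = 1 := by
    filter_upwards [hA.det.continuousAt.eventually_ne hdet] with s hs
    exact mul_nonsing_inv _ (isUnit_iff_ne_zero.2 hs)
  have hone : HasMatrixDerivAt (fun s => A s * (A s)⁻¹) 0 t := by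
    intro i j
    refine (hasDerivAt_const t ((1 : Matrix p p ℝ) i j)).congr_of_eventuallyEq ?_
    filter_upwards [hev] with s hs
    rw [hs]
  have h := (hA.mul hB).unique hone
  have hu : IsUnit (A t).det := isUnit_iff_ne_zero.2 hdet
  have h4 : B' = -((A t)⁻¹ * A' * (A t)⁻¹) := by
    have h5 : (A t)⁻¹ * (A' * (A t)⁻¹ + A t * B') = 0 := by rw [h, Matrix.mul_zero]
    rw [Matrix.mul_add, nonsing_inv_mul_cancel_left _ _ hu, ← Matrix.mul_assoc] at h5
    exact eq_neg_of_add_eq_zero_right h5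
  rw [← h4]
  exact hB

end Calculus

/-! ### A scalar autonomous equation. -/

section Primitive

/-- The autonomous equation `s' = 1 / g s` with `g` continuous and bounded below by a positive
constant has an increasing global solution which is surjective onto `ℝ`. -/
theorem exists_global_solution (g : ℝ → ℝ) (hg : Continuous g) {c : ℝ} (hc : 0 < c)
    (hcg : ∀ x, c ≤ g x) (s₀ : ℝ) :
    ∃ s : ℝ → ℝ, s 0 = s₀ ∧ (∀ t, HasDerivAt s (g (s t))⁻¹ t) ∧ Tendsto s atTop atTop ∧
      Tendsto s atBot atBot := by
  -- Separation of variables: `H` is the time needed to travel from `s₀` to `x`, and the solution is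
  -- its inverse.
  let H : ℝ → ℝ := fun x => ∫ y in s₀..x, g y
  have hH : ∀ x, HasDerivAt H (g x) x := fun x => hg.integral_hasStrictDerivAt s₀ x |>.hasDerivAt
  have hpos : ∀ x, 0 < g x := fun x => hc.trans_le (hcg x)
  have hmono : StrictMono H := strictMono_of_deriv_pos fun x => by rw [(hH x).deriv]; exact hpos x
  have hcont : Continuous H := continuous_iff_continuousAt.2 fun x => (hH x).continuousAt
  -- Comparison with a line of slope `c` makes `H` unbounded on both sides, so its inverse is
  -- defined for all times.
  have hmono' : Monotone fun x => H x - c * x := by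
    have h : ∀ x, HasDerivAt (fun x => H x - c * x) (g x - c) x := fun x => by
      simpa using (hH x).fun_sub ((hasDerivAt_id x).const_mul c)
    refine monotone_of_deriv_nonneg (fun x => (h x).differentiableAt) fun x => ?_
    rw [(h x).deriv]
    linarith [hcg x]
  have htop : Tendsto H atTop atTop := by
    refine tendsto_atTop_mono' _ (f₁ := fun x => c * x + (H 0 - c * 0)) ?_ ?_
    · filter_upwards [eventually_ge_atTop 0] with x hx
      linarith [hmono' hx]
    · exact tendsto_atTop_add_const_right _ _ (tendsto_id.const_mul_atTop hc)
  have hbot : Tendsto H atBot atBot := by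
    refine tendsto_atBot_mono' _ (f₁ := fun x => c * x + (H 0 - c * 0)) ?_ ?_
    · filter_upwards [eventually_le_atBot 0] with x hx
      linarith [hmono' hx]
    · exact tendsto_atBot_add_const_right _ _ (tendsto_id.const_mul_atBot hc)
  let e : ℝ ≃o ℝ := hmono.orderIsoOfSurjective H (hcont.surjective htop hbot)
  have he : ∀ x, e x = H x := fun x => rfl
  refine ⟨e.symm, ?_, fun t => ?_, e.symm.tendsto_atTop, e.symm.tendsto_atBot⟩
  · rw [OrderIso.symm_apply_eq, he]
    simp [H]
  · refine HasDerivAt.of_local_left_inverse e.symm.continuous.continuousAt (hH _) (hpos _).ne' ?_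
    exact Eventually.of_forall fun y => e.apply_symm_apply y

end Primitive

/-! ### Gram matrices, the orthogonal projection and the weights. -/

section Gram

variable {m n : ℕ}

/-- The diagonal matrix `diag(λ₁⁻², …, λₙ⁻²)`. -/
noncomputable def invSqDiag (lam : Fin n → ℝ) : Matrix (Fin n) (Fin n) ℝ :=
  diagonal fun j => (lam j ^ 2)⁻¹

/-- The Gram matrix of the rows of `X` for the quadratic form `∑ x_j² / λ_j²`. -/
noncomputable def scaledGram (lam : Fin n → ℝ) (X : Matrix (Fin m) (Fin n) ℝ) :
    Matrix (Fin m) (Fin m) ℝ :=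
  X * invSqDiag lam * Xᵀ

theorem gram_rescale (lam : Fin n → ℝ) (X : Matrix (Fin m) (Fin n) ℝ) :
    gram (rescale lam X) = scaledGram lam X := by
  ext α β
  rw [scaledGram, invSqDiag, mul_apply]
  simp only [gram, rescale, of_apply, mul_diagonal, transpose_apply]
  refine Finset.sum_congr rfl fun j _ => ?_
  ring

theorem vecMul_injective_of_rank {X : Matrix (Fin m) (Fin n) ℝ} (hX : X.rank = m) :
    Function.Injective fun v => v ᵥ* X := by
  rw [vecMul_injective_iff, linearIndependent_iff_card_eq_finrank_span, Set.finrank,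
    ← rank_eq_finrank_span_row, hX, Fintype.card_fin]

theorem gram_posDef {X : Matrix (Fin m) (Fin n) ℝ} (hX : X.rank = m) : (gram X).PosDef := by
  rw [gram_eq]
  simpa using (PosDef.one (n := Fin n) (R := ℝ)).mul_mul_conjTranspose_same
    (vecMul_injective_of_rank hX)

theorem scaledGram_posDef {lam : Fin n → ℝ} (hpos : ∀ j, 0 < lam j)
    {X : Matrix (Fin m) (Fin n) ℝ} (hX : X.rank = m) : (scaledGram lam X).PosDef := by
  have hD : (invSqDiag lam).PosDef :=
    PosDef.diagonal fun j => inv_pos.2 (pow_pos (hpos j) 2)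
  simpa [scaledGram] using hD.mul_mul_conjTranspose_same (vecMul_injective_of_rank hX)

theorem vecMul_dotProduct_mulVec_vecMul (X : Matrix (Fin m) (Fin n) ℝ)
    (M : Matrix (Fin n) (Fin n) ℝ) (b c : Fin m → ℝ) :
    (b ᵥ* X) ⬝ᵥ (M *ᵥ (c ᵥ* X)) = b ⬝ᵥ ((X * M * Xᵀ) *ᵥ c) := by
  rw [← mulVec_transpose X c, ← dotProduct_mulVec, mulVec_mulVec, mulVec_mulVec, Matrix.mul_assoc]

/-- The matrix of the orthogonal projection onto the row space. -/
noncomputable def projection : Gr m n → Matrix (Fin n) (Fin n) ℝ :=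
  Quotient.lift (fun X : FullRank m n => X.1ᵀ * (gram X.1)⁻¹ * X.1)
    (by
      rintro X Y ⟨A, h⟩
      have hA : IsUnit (A : Matrix (Fin m) (Fin m) ℝ).det := (isUnit_iff_isUnit_det _).1 A.isUnit
      have hA' : IsUnit (A : Matrix (Fin m) (Fin m) ℝ)ᵀ.det := by rwa [det_transpose]
      simp only [h, gram_eq, transpose_mul]
      generalize (A : Matrix (Fin m) (Fin m) ℝ) = B at *
      have h1 : B * X.1 * (X.1ᵀ * Bᵀ) = B * (X.1 * X.1ᵀ) * Bᵀ := by simp only [Matrix.mul_assoc]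
      rw [h1, Matrix.mul_inv_rev, Matrix.mul_inv_rev]
      simp only [Matrix.mul_assoc]
      rw [nonsing_inv_mul_cancel_left _ _ hA, mul_nonsing_inv_cancel_left _ _ hA'])

/-- The squared length of the projection of the `j`-th basis vector onto the subspace. -/
noncomputable def weight (j : Fin n) (V : Gr m n) : ℝ := projection V j j

theorem projection_proj (X : FullRank m n) :
    projection (proj X) = X.1ᵀ * (gram X.1)⁻¹ * X.1 := rfl

theorem weight_proj (j : Fin n) (X : FullRank m n) :
    weight j (proj X) = X.1.col j ⬝ᵥ ((gram X.1)⁻¹ *ᵥ X.1.col j) := by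
  rw [weight, projection_proj, Matrix.mul_assoc, mul_apply]
  rfl

theorem f_proj (lam : Fin n → ℝ) (X : FullRank m n) :
    f lam (proj X) = (gram X.1).det / (scaledGram lam X.1).det := by
  rw [← gram_rescale]
  rfl

theorem f_pos {lam : Fin n → ℝ} (hpos : ∀ j, 0 < lam j) (V : Gr m n) : 0 < f lam V := by
  induction V using Quotient.inductionOn with
  | h X =>
    change 0 < f lam (proj X)
    rw [f_proj]
    exact div_pos (gram_posDef X.2).det_pos (scaledGram_posDef hpos X.2).det_pos

theorem continuous_proj : Continuous (proj : FullRank m n → Gr m n) := continuous_quotient_mk'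

theorem continuous_gram : Continuous (gram : Matrix (Fin m) (Fin n) ℝ → _) := by
  have h : (gram : Matrix (Fin m) (Fin n) ℝ → _) = fun X => X * Xᵀ := funext gram_eq
  rw [h]
  fun_prop

theorem continuous_f {lam : Fin n → ℝ} (hpos : ∀ j, 0 < lam j) :
    Continuous (f lam : Gr m n → ℝ) := by
  refine Continuous.quotient_lift ?_ _
  simp only [gram_rescale]
  refine Continuous.div ?_ ?_ fun X => (scaledGram_posDef hpos X.2).det_pos.ne'
  · exact (continuous_gram.comp continuous_subtype_val).matrix_det
  · refine Continuous.matrix_det ?_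
    unfold scaledGram
    fun_prop

theorem continuous_weight (j : Fin n) : Continuous (weight j : Gr m n → ℝ) := by
  have h : Continuous (projection : Gr m n → _) := by
    refine Continuous.quotient_lift ?_ _
    have h1 : Continuous fun X : FullRank m n => (gram X.1)⁻¹ := by
      have h2 : (fun X : FullRank m n => (gram X.1)⁻¹) =
          fun X => ((gram X.1).det)⁻¹ • (gram X.1).adjugate := by
        ext1 X
        rw [inv_def, Ring.inverse_eq_inv']
      have h3 : Continuous fun X : FullRank m n => gram X.1 :=
        continuous_gram.comp continuous_subtype_val
      rw [h2]
      exact (h3.matrix_det.inv₀ fun X => (gram_posDef X.2).det_pos.ne').smul h3.matrix_adjugate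
    fun_prop
  exact h.matrix_elem j j

theorem weight_proj_eq (j : Fin n) (X : FullRank m n) :
    weight j (proj X) = (((gram X.1)⁻¹ *ᵥ X.1.col j) ᵥ* X.1) j := by
  rw [weight_proj, dotProduct_comm]
  rfl

/-- The vector on the right is `P e_j`, so this is `⟨e_j, P e_j⟩ = |P e_j|²`, that is `P² = P = Pᵀ`.
-/
theorem weight_proj_eq_sq (j : Fin n) (X : FullRank m n) :
    weight j (proj X) = (((gram X.1)⁻¹ *ᵥ X.1.col j) ᵥ* X.1) ⬝ᵥ
      (((gram X.1)⁻¹ *ᵥ X.1.col j) ᵥ* X.1) := by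
  have h := vecMul_dotProduct_mulVec_vecMul X.1 1 ((gram X.1)⁻¹ *ᵥ X.1.col j)
    ((gram X.1)⁻¹ *ᵥ X.1.col j)
  rw [one_mulVec, Matrix.mul_one, ← gram_eq, mulVec_mulVec, 
    mul_nonsing_inv _ (isUnit_iff_ne_zero.2 (gram_posDef X.2).det_pos.ne'), one_mulVec] at h
  rw [h, weight_proj, dotProduct_comm]

theorem col_eq_zero_of_weight {j : Fin n} {X : FullRank m n} (h : weight j (proj X) = 0) :
    X.1.col j = 0 := by
  rw [weight_proj] at h
  by_contra hne
  have h1 := (gram_posDef X.2).inv.dotProduct_mulVec_pos hne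
  simp only [star_trivial] at h1
  exact h1.ne' h

theorem weight_eq_zero_of_col {j : Fin n} {X : FullRank m n} (h : X.1.col j = 0) :
    weight j (proj X) = 0 := by
  rw [weight_proj, h, zero_dotProduct]

/-- Since `|P e_j - e_j|² = |P e_j|² - 2 P_jj + 1 = 1 - P_jj`, weight one forces `P e_j = e_j`. -/
theorem exists_vecMul_of_weight {j : Fin n} {X : FullRank m n} (h : weight j (proj X) = 1) :
    ∃ c, c ᵥ* X.1 = Pi.single j 1 := by
  refine ⟨(gram X.1)⁻¹ *ᵥ X.1.col j, ?_⟩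
  have h1 := weight_proj_eq j X
  have h2 := weight_proj_eq_sq j X
  set u := ((gram X.1)⁻¹ *ᵥ X.1.col j) ᵥ* X.1
  have h3 : (u - Pi.single j 1) ⬝ᵥ (u - Pi.single j 1) = 0 := by
    simp [sub_dotProduct, dotProduct_sub, ← h2, ← h1, h]
  exact sub_eq_zero.1 (dotProduct_self_eq_zero.1 h3)

theorem weight_eq_one_of_vecMul {j : Fin n} {X : FullRank m n} {c : Fin m → ℝ}
    (h : c ᵥ* X.1 = Pi.single j 1) : weight j (proj X) = 1 := by
  have hu := isUnit_iff_ne_zero.2 (gram_posDef X.2).det_pos.ne'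
  have h1 : X.1.col j = gram X.1 *ᵥ c := by
    rw [gram_eq, ← mulVec_mulVec, mulVec_transpose, h, mulVec_single_one]
  rw [weight_proj_eq, h1, mulVec_mulVec, nonsing_inv_mul _ hu, one_mulVec, h, Pi.single_eq_same]

end Gram

/-! ### Cauchy–Schwarz comparison of the two dual quadratic forms. -/

section Inequalities

variable {m n : ℕ}

/-- The dual quadratic form of `scaledGram`, evaluated at the `l`-th column. -/
noncomputable def scaledWeight (lam : Fin n → ℝ) (l : Fin n) (X : Matrix (Fin m) (Fin n) ℝ) : ℝ :=
  X.col l ⬝ᵥ ((scaledGram lam X)⁻¹ *ᵥ X.col l)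

/-- Cauchy–Schwarz for `u` and `d w` gives `p² ≤ p |d w|²`, and `|d w|² ≤ D q` because `d ≤ D` on
the support of `w`. -/
theorem dotProduct_self_le_of_le {n : Type*} [Fintype n] {u w d : n → ℝ} {p q D : ℝ}
    (huu : u ⬝ᵥ u = p) (huw : u ⬝ᵥ (d * w) = p) (hww : w ⬝ᵥ (d * w) = q)
    (hd : ∀ j, 0 ≤ d j) (h : ∀ j, w j ≠ 0 → d j ≤ D) : p ≤ D * q := by
  have hcs : p ^ 2 ≤ p * ((d * w) ⬝ᵥ (d * w)) := by
    have := Finset.sum_mul_sq_le_sq_mul_sq Finset.univ u (d * w)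
    simp only [dotProduct] at huu huw ⊢
    simp only [pow_two] at this ⊢
    rwa [huu, huw] at this
  have hle : (d * w) ⬝ᵥ (d * w) ≤ D * q := by
    rw [← hww, dotProduct, dotProduct, Finset.mul_sum]
    refine Finset.sum_le_sum fun j _ => ?_
    by_cases hj : w j = 0
    · simp [hj]
    · have h1 := mul_le_mul_of_nonneg_right (h j hj) (mul_nonneg (hd j) (mul_self_nonneg (w j)))
      simp only [Pi.mul_apply]
      linarith
  have hp : 0 ≤ p := huu ▸ Finset.sum_nonneg fun j _ => mul_self_nonneg (u j)
  rcases hp.eq_or_lt with h0 | h0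
  · have : 0 ≤ (d * w) ⬝ᵥ (d * w) := Finset.sum_nonneg fun j _ => mul_self_nonneg _
    linarith
  · nlinarith

/-- Cauchy–Schwarz for `u` and `w` gives `q² ≤ p |w|²`, and `D |w|² ≤ q` because `d ≥ D` on the
support of `w`. -/
theorem le_dotProduct_self_of_le {n : Type*} [Fintype n] {u w d : n → ℝ} {p q D : ℝ}
    (huu : u ⬝ᵥ u = p) (huw : u ⬝ᵥ w = q) (hww : w ⬝ᵥ (d * w) = q)
    (hd : ∀ j, 0 ≤ d j) (hD : 0 ≤ D) (h : ∀ j, w j ≠ 0 → D ≤ d j) : D * q ≤ p := by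
  have hcs : q ^ 2 ≤ p * (w ⬝ᵥ w) := by
    have := Finset.sum_mul_sq_le_sq_mul_sq Finset.univ u w
    simp only [dotProduct] at huu huw ⊢
    simp only [pow_two] at this ⊢
    rwa [huu, huw] at this
  have hle : D * (w ⬝ᵥ w) ≤ q := by
    rw [← hww, dotProduct, dotProduct, Finset.mul_sum]
    refine Finset.sum_le_sum fun j _ => ?_
    by_cases hj : w j = 0
    · simp [hj]
    · have h1 := mul_le_mul_of_nonneg_right (h j hj) (mul_self_nonneg (w j))
      simp only [Pi.mul_apply]
      linarith
  have hp : 0 ≤ p := huu ▸ Finset.sum_nonneg fun j _ => mul_self_nonneg (u j)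
  have hq : 0 ≤ q := by
    rw [← hww]
    refine Finset.sum_nonneg fun j _ => ?_
    have := mul_nonneg (hd j) (mul_self_nonneg (w j))
    simp only [Pi.mul_apply]
    linarith
  rcases hq.eq_or_lt with h0 | h0
  · rw [← h0]; simpa using hp
  · have h1 : D * q ^ 2 ≤ p * q := by
      calc D * q ^ 2 ≤ D * (p * (w ⬝ᵥ w)) := by gcongr
        _ = p * (D * (w ⬝ᵥ w)) := by ring
        _ ≤ p * q := by gcongr
    nlinarith

variable {lam : Fin n → ℝ}

theorem scaledWeight_nonneg (hpos : ∀ j, 0 < lam j) (l : Fin n) (X : FullRank m n) :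
    0 ≤ scaledWeight lam l X.1 := by
  have h := (scaledGram_posDef hpos X.2).inv.posSemidef.dotProduct_mulVec_nonneg (X.1.col l)
  simpa [scaledWeight] using h

/-- The relations between the two dual vectors attached to the `l`-th column. -/
theorem exists_dual_vectors (hpos : ∀ j, 0 < lam j) (l : Fin n) (X : FullRank m n) :
    ∃ u w : Fin n → ℝ, u ⬝ᵥ u = weight l (proj X) ∧
      u ⬝ᵥ ((fun j => (lam j ^ 2)⁻¹) * w) = weight l (proj X) ∧
      u ⬝ᵥ w = scaledWeight lam l X.1 ∧
      w ⬝ᵥ ((fun j => (lam j ^ 2)⁻¹) * w) = scaledWeight lam l X.1 ∧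
      ∀ j, j ≠ l → (weight j (proj X) = 0 ∨ weight j (proj X) = 1) → w j = 0 := by
  set b := (gram X.1)⁻¹ *ᵥ X.1.col l with hb
  set c := (scaledGram lam X.1)⁻¹ *ᵥ X.1.col l with hc
  have hG := isUnit_iff_ne_zero.2 (gram_posDef X.2).det_pos.ne'
  have hS := isUnit_iff_ne_zero.2 (scaledGram_posDef hpos X.2).det_pos.ne'
  have hGb : gram X.1 *ᵥ b = X.1.col l := by
    rw [hb, mulVec_mulVec, mul_nonsing_inv _ hG, one_mulVec]
  have hSc : scaledGram lam X.1 *ᵥ c = X.1.col l := by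
    rw [hc, mulVec_mulVec, mul_nonsing_inv _ hS, one_mulVec]
  have hD : ∀ v : Fin n → ℝ, (fun j => (lam j ^ 2)⁻¹) * v = invSqDiag lam *ᵥ v := by
    intro v
    ext j
    simp [invSqDiag, mulVec_diagonal]
  refine ⟨b ᵥ* X.1, c ᵥ* X.1, (weight_proj_eq_sq l X).symm, ?_, ?_, ?_, ?_⟩
  · rw [hD, vecMul_dotProduct_mulVec_vecMul, ← scaledGram, hSc, weight_proj, dotProduct_comm]
  · have h := vecMul_dotProduct_mulVec_vecMul X.1 1 c b
    rw [one_mulVec, Matrix.mul_one, ← gram_eq, hGb] at h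
    rw [dotProduct_comm, h, scaledWeight, dotProduct_comm]
  · rw [hD, vecMul_dotProduct_mulVec_vecMul, ← scaledGram, hSc, scaledWeight, dotProduct_comm]
  -- With weight 0 the `j`-th column vanishes. With weight 1 some `a` satisfies `a X = e_j`, and
  -- pairing with `S c = x_l` gives `λ_j⁻² w_j = a · x_l = (e_j)_l = 0`.
  · rintro j hj (h | h)
    · have h1 := col_eq_zero_of_weight h
      change c ⬝ᵥ X.1.col j = 0
      rw [h1, dotProduct_zero]
    · obtain ⟨a, ha⟩ := exists_vecMul_of_weight h
      have h1 := vecMul_dotProduct_mulVec_vecMul X.1 (invSqDiag lam) a c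
      rw [← scaledGram, hSc, ha, ← hD] at h1
      have h2 : a ⬝ᵥ X.1.col l = 0 := by
        change (a ᵥ* X.1) l = 0
        rw [ha, Pi.single_eq_of_ne hj.symm]
      rw [h2, single_one_dotProduct, Pi.mul_apply] at h1
      exact (mul_eq_zero.1 h1).resolve_left (inv_pos.2 (pow_pos (hpos j) 2)).ne'

/-- Indices with `λ_j⁻² > λ_l⁻²` are those with `λ_j < λ_l`; their weights are 0 or 1, so they drop
out of the support of `w`. -/
theorem weight_le_scaledWeight (hpos : ∀ j, 0 < lam j) (l : Fin n) (X : FullRank m n)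
    (h : ∀ j, lam j < lam l → weight j (proj X) = 0 ∨ weight j (proj X) = 1) :
    weight l (proj X) ≤ (lam l ^ 2)⁻¹ * scaledWeight lam l X.1 := by
  obtain ⟨u, w, h1, h2, -, h4, h5⟩ := exists_dual_vectors hpos l X
  refine dotProduct_self_le_of_le h1 h2 h4 (fun j => by positivity) fun j hj => ?_
  by_contra! hlt
  have hlt' : lam j < lam l := by
    by_contra! hle
    refine hlt.not_ge (inv_anti₀ (pow_pos (hpos l) 2) ?_)
    exact pow_le_pow_left₀ (hpos l).le hle 2
  exact hj (h5 j (fun e => hlt'.ne (by rw [e])) (h j hlt'))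

/-- Two choices of `r` are needed: `r = l` gives the monotonicity statement, and `r` maximizing `λ`
makes the hypothesis vacuous and gives a crude bound on `q_l` by `w_l`. -/
theorem scaledWeight_le_weight (hpos : ∀ j, 0 < lam j) (l r : Fin n) (X : FullRank m n)
    (h : ∀ j, lam r < lam j → j ≠ l ∧ (weight j (proj X) = 0 ∨ weight j (proj X) = 1)) :
    (lam r ^ 2)⁻¹ * scaledWeight lam l X.1 ≤ weight l (proj X) := by
  obtain ⟨u, w, h1, -, h3, h4, h5⟩ := exists_dual_vectors hpos l X
  refine le_dotProduct_self_of_le h1 h3 h4 (fun j => by positivity) (by positivity) fun j hj => ?_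
  by_contra! hlt
  have hlt' : lam r < lam j := by
    by_contra! hle
    refine hlt.not_ge (inv_anti₀ (pow_pos (hpos j) 2) ?_)
    exact pow_le_pow_left₀ (hpos j).le hle 2
  exact hj (h5 j (h j hlt').1 (h j hlt').2)

end Inequalities

/-! ### The gradient of `f` and the evolution of the weights in a chart. -/

section Chart

variable {m n : ℕ}

theorem sum_eq_sum_range_add_sum_free (I : Fin m ↪o Fin n) (φ : Fin n → ℝ) :
    ∑ j, φ j = ∑ α, φ (I α) + ∑ j : Free I, φ j := by
  classical
  have h := Fintype.sum_subtype_add_sum_subtype (fun j => ∃ α, I α = j) φ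
  rw [← h]
  congr 1
  · exact (Fintype.sum_equiv (κ := {j // ∃ α, I α = j}) (Equiv.ofInjective I I.injective) _
      (fun j => φ j) fun α => rfl).symm
  · refine Fintype.sum_equiv (Equiv.subtypeEquivRight fun j => ?_) _ _ fun j => rfl
    push Not
    rfl

theorem chartMatrix_free (I : Fin m ↪o Fin n) (Z : Coord I) (α : Fin m) (j : Free I) :
    chartMatrix I Z α j = Z α j := by
  simp [chartMatrix, j.2]

theorem chartMatrix_range (I : Fin m ↪o Fin n) (Z : Coord I) (α β : Fin m) :
    chartMatrix I Z α (I β) = (1 : Matrix (Fin m) (Fin m) ℝ) α β := by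
  rw [← chartMatrix_submatrix I Z]
  rfl

/-- The tangent direction at a chart matrix with coordinates `V`. -/
def chartDir (I : Fin m ↪o Fin n) (V : Coord I) : Matrix (Fin m) (Fin n) ℝ :=
  of fun α j => if h : ∀ β, I β ≠ j then V α ⟨j, h⟩ else 0

theorem chartDir_free (I : Fin m ↪o Fin n) (V : Coord I) (α : Fin m) (j : Free I) :
    chartDir I V α j = V α j := by
  simp [chartDir, j.2]

theorem chartDir_range (I : Fin m ↪o Fin n) (V : Coord I) (α β : Fin m) :
    chartDir I V α (I β) = 0 := by
  simp [chartDir]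

theorem eq_range_or_free (I : Fin m ↪o Fin n) (j : Fin n) :
    (∃ α, I α = j) ∨ ∃ i : Free I, (i : Fin n) = j := by
  by_cases h : ∃ α, I α = j
  · exact Or.inl h
  · exact Or.inr ⟨⟨j, fun α hα => h ⟨α, hα⟩⟩, rfl⟩

theorem hasMatrixDerivAt_chartMatrix (I : Fin m ↪o Fin n) {z : ℝ → Coord I} {V : Coord I} {t : ℝ}
    (hz : HasDerivAt z V t) :
    HasMatrixDerivAt (fun s => chartMatrix I (z s)) (chartDir I V) t := by
  intro α j
  rcases eq_range_or_free I j with ⟨β, rfl⟩ | ⟨i, rfl⟩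
  · simp only [chartMatrix_range, chartDir_range]
    exact hasDerivAt_const t _
  · simp only [chartMatrix_free, chartDir_free]
    exact hasDerivAt_pi.1 (hasDerivAt_pi.1 hz α) i

/-- The diagonal matrix of the `λ_j⁻²` with `j` in the multi-index. -/
noncomputable def invSqRange (lam : Fin n → ℝ) (I : Fin m ↪o Fin n) :
    Matrix (Fin m) (Fin m) ℝ :=
  diagonal fun α => (lam (I α) ^ 2)⁻¹

/-- The diagonal matrix of the `λ_j⁻²` with `j` outside the multi-index. -/
noncomputable def invSqFree (lam : Fin n → ℝ) (I : Fin m ↪o Fin n) :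
    Matrix (Free I) (Free I) ℝ :=
  diagonal fun j => (lam j ^ 2)⁻¹

theorem gram_chartMatrix (I : Fin m ↪o Fin n) (Z : Coord I) :
    gram (chartMatrix I Z) = 1 + of Z * (of Z)ᵀ := by
  ext α β
  rw [gram, of_apply, sum_eq_sum_range_add_sum_free I]
  simp [chartMatrix_free, chartMatrix_range, mul_apply, one_apply]

theorem scaledGram_chartMatrix (lam : Fin n → ℝ) (I : Fin m ↪o Fin n) (Z : Coord I) :
    scaledGram lam (chartMatrix I Z) =
      invSqRange lam I + of Z * invSqFree lam I * (of Z)ᵀ := by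
  ext α β
  rw [scaledGram, mul_apply, sum_eq_sum_range_add_sum_free I, Matrix.add_apply,
    mul_apply (M := _ * _)]
  simp only [invSqDiag, invSqRange, invSqFree, mul_diagonal, transpose_apply, chartMatrix_free,
    chartMatrix_range, of_apply]
  congr 1
  simp only [one_apply, ite_mul, one_mul, zero_mul, mul_ite, mul_one, mul_zero,
    diagonal_apply]
  rw [Finset.sum_ite_eq Finset.univ β]
  rw [if_pos (Finset.mem_univ _)]
  split_ifs with h
  · rw [h]
  · rfl

theorem trace_mul_chartDir_transpose (I : Fin m ↪o Fin n) (A : Matrix (Fin m) (Fin n) ℝ)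
    (V : Coord I) :
    (A * (chartDir I V)ᵀ).trace = (A.submatrix id Subtype.val * (of V)ᵀ).trace := by
  simp only [trace, diag, mul_apply, transpose_apply]
  refine Finset.sum_congr rfl fun α _ => ?_
  rw [sum_eq_sum_range_add_sum_free I]
  simp only [chartDir_free, chartDir_range, mul_zero, Finset.sum_const_zero, zero_add]
  rfl

theorem hasDerivAt_f_chartPoint {lam : Fin n → ℝ} (hpos : ∀ j, 0 < lam j) (I : Fin m ↪o Fin n)
    {z : ℝ → Coord I} {V : Coord I} {t : ℝ} (hz : HasDerivAt z V t) :
    HasDerivAt (fun s => f lam (chartPoint I (z s)))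
      (2 * f lam (chartPoint I (z t)) * (((gram (chartMatrix I (z t)))⁻¹ * of (z t) -
        (scaledGram lam (chartMatrix I (z t)))⁻¹ * of (z t) * invSqFree lam I) *
          (of V)ᵀ).trace) t := by
  have hX := hasMatrixDerivAt_chartMatrix I hz
  have hdiv := (hX.mul hX.transpose).det.fun_div
    (((hX.mul_const (invSqDiag lam)).mul hX.transpose).det)
    (scaledGram_posDef hpos (chartMatrix_rank I (z t))).det_pos.ne'
  have hf : ∀ Z : Coord I, f lam (chartPoint I Z) =
      (gram (chartMatrix I Z)).det / (scaledGram lam (chartMatrix I Z)).det :=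
    fun Z => f_proj lam ⟨chartMatrix I Z, chartMatrix_rank I Z⟩
  simp only [hf, gram_eq, scaledGram]
  refine hdiv.congr_deriv ?_
  simp only [← gram_eq]
  rw [← scaledGram]
  set X := chartMatrix I (z t) with hXdef
  set W := chartDir I V
  have hG := (gram_posDef (chartMatrix_rank I (z t))).det_pos.ne'
  have hS := (scaledGram_posDef hpos (chartMatrix_rank I (z t))).det_pos.ne'
  rw [← hXdef] at hG hS
  -- The two terms of the product rule are transposes of each other, so their traces against the
  -- symmetric `M⁻¹` agree; this treats numerator (`D = 1`) and denominator at once.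
  have key : ∀ (M : Matrix (Fin m) (Fin m) ℝ) (D : Matrix (Fin n) (Fin n) ℝ), M.det ≠ 0 →
      Mᵀ = M → Dᵀ = D →
      (M.adjugate * (W * D * Xᵀ + X * D * Wᵀ)).trace = 2 * M.det * (M⁻¹ * X * D * Wᵀ).trace := by
    intro M D hM hMt hDt
    have h1 : M.adjugate = M.det • M⁻¹ := by
      rw [inv_def, Ring.inverse_eq_inv', smul_smul, mul_inv_cancel₀ hM, one_smul]
    have h2 : (M⁻¹ * (W * D * Xᵀ)).trace = (M⁻¹ * X * D * Wᵀ).trace := by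
      rw [← trace_transpose]
      simp only [transpose_mul, transpose_transpose, transpose_nonsing_inv, hMt, hDt]
      rw [trace_mul_comm]
      simp only [Matrix.mul_assoc]
    rw [h1, Matrix.smul_mul, trace_smul, Matrix.mul_add, trace_add, h2, smul_eq_mul]
    simp only [Matrix.mul_assoc]
    ring
  have hGt : (gram X)ᵀ = gram X := by rw [gram_eq, transpose_mul, transpose_transpose]
  have hDt : (invSqDiag lam)ᵀ = invSqDiag lam := diagonal_transpose _
  have hSt : (scaledGram lam X)ᵀ = scaledGram lam X := by
    rw [scaledGram, transpose_mul, transpose_mul, transpose_transpose, hDt, Matrix.mul_assoc]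
  have k1 := key (gram X) 1 hG hGt transpose_one
  have k2 := key (scaledGram lam X) (invSqDiag lam) hS hSt hDt
  simp only [Matrix.mul_one] at k1
  rw [k1, k2, trace_mul_chartDir_transpose, trace_mul_chartDir_transpose, Matrix.sub_mul,
    trace_sub]
  have e1 : ((gram X)⁻¹ * X).submatrix id (Subtype.val : Free I → Fin n) =
      (gram X)⁻¹ * of (z t) := by
    ext α j
    simp [mul_apply, hXdef, chartMatrix_free]
  have e2 : ((scaledGram lam X)⁻¹ * X * invSqDiag lam).submatrix id
      (Subtype.val : Free I → Fin n) = (scaledGram lam X)⁻¹ * of (z t) * invSqFree lam I := by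
    ext α j
    rw [submatrix_apply, invSqDiag, invSqFree, mul_diagonal, mul_diagonal]
    simp [mul_apply, hXdef, chartMatrix_free]
  rw [e1, e2]
  field_simp
  rfl

theorem differentiable_det {E ι : Type*} [NormedAddCommGroup E] [NormedSpace ℝ E] [Fintype ι]
    [DecidableEq ι] {A : E → Matrix ι ι ℝ} (hA : ∀ i j, Differentiable ℝ fun x => A x i j) :
    Differentiable ℝ fun x => (A x).det := by
  simp only [det_apply]
  refine Differentiable.fun_sum fun σ _ => ?_
  refine Differentiable.fun_const_smul ?_ _
  intro x
  have h := (HasFDerivAt.finsetProd (u := Finset.univ)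
    fun i _ => (hA (σ i) i x).hasFDerivAt).differentiableAt
  exact h

/-- Directional derivatives alone do not determine `fderiv`, which would be zero by default without
this. -/
theorem differentiable_f_chartPoint {lam : Fin n → ℝ} (hpos : ∀ j, 0 < lam j)
    (I : Fin m ↪o Fin n) : Differentiable ℝ fun Z : Coord I => f lam (chartPoint I Z) := by
  have hf : ∀ Z : Coord I, f lam (chartPoint I Z) =
      (gram (chartMatrix I Z)).det / (scaledGram lam (chartMatrix I Z)).det :=
    fun Z => f_proj lam ⟨chartMatrix I Z, chartMatrix_rank I Z⟩
  simp only [hf]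
  have hX : ∀ α j, Differentiable ℝ fun Z : Coord I => chartMatrix I Z α j := by
    intro α j
    rcases eq_range_or_free I j with ⟨β, rfl⟩ | ⟨i, rfl⟩
    · simp only [chartMatrix_range]
      fun_prop
    · simp only [chartMatrix_free]
      fun_prop
  simp only [div_eq_mul_inv]
  refine Differentiable.fun_mul ?_ (Differentiable.fun_inv ?_ fun Z =>
    (scaledGram_posDef hpos (chartMatrix_rank I Z)).det_pos.ne')
  · refine differentiable_det fun α β => ?_
    simp only [gram, of_apply]
    fun_prop
  · refine differentiable_det fun α β => ?_
    have h : ∀ Z : Coord I, scaledGram lam (chartMatrix I Z) α β =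
        ∑ j, chartMatrix I Z α j * (lam j ^ 2)⁻¹ * chartMatrix I Z β j := fun Z => by
      rw [scaledGram, invSqDiag, Matrix.mul_apply]
      simp only [mul_diagonal, transpose_apply]
    simp only [h]
    fun_prop

theorem fderiv_f_chartPoint {lam : Fin n → ℝ} (hpos : ∀ j, 0 < lam j) (I : Fin m ↪o Fin n)
    (Z W : Coord I) :
    fderiv ℝ (fun Y : Coord I => f lam (chartPoint I Y)) Z W =
      2 * f lam (chartPoint I Z) * (((gram (chartMatrix I Z))⁻¹ * of Z -
        (scaledGram lam (chartMatrix I Z))⁻¹ * of Z * invSqFree lam I) * (of W)ᵀ).trace := by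
  have hz : HasDerivAt (fun s : ℝ => Z + s • W) W 0 := by
    simpa using ((hasDerivAt_id (0 : ℝ)).smul_const W).const_add Z
  have h1 := hasDerivAt_f_chartPoint hpos I hz
  have h0 : Z + (0 : ℝ) • W = Z := by simp
  have h2 : HasFDerivAt (fun Y : Coord I => f lam (chartPoint I Y))
      (fderiv ℝ (fun Y : Coord I => f lam (chartPoint I Y)) Z) (Z + (0 : ℝ) • W) := by
    rw [h0]
    exact (differentiable_f_chartPoint hpos I Z).hasFDerivAt
  have h3 := h2.comp_hasDerivAt 0 hz
  rw [h0] at h1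
  exact h3.unique h1

/-- The gradient in a chart. -/
theorem isGradient_iff {lam : Fin n → ℝ} (hpos : ∀ j, 0 < lam j) (I : Fin m ↪o Fin n)
    (Z V : Coord I) :
    IsGradient lam I Z V ↔ of V = -((2 * f lam (chartPoint I Z)) •
      (gram (chartMatrix I Z) * (scaledGram lam (chartMatrix I Z))⁻¹ *
        (of Z * invSqFree lam I - invSqRange lam I * of Z))) := by
  have hG := isUnit_iff_ne_zero.2 (gram_posDef (chartMatrix_rank I Z)).det_pos.ne'
  have hS := isUnit_iff_ne_zero.2 (scaledGram_posDef hpos (chartMatrix_rank I Z)).det_pos.ne'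
  have hGZ := gram_chartMatrix I Z
  have hSZ := scaledGram_chartMatrix lam I Z
  set G := gram (chartMatrix I Z)
  set S := scaledGram lam (chartMatrix I Z)
  set D := invSqFree lam I
  set E := invSqRange lam I
  set Y : Matrix (Fin m) (Free I) ℝ := of Z
  set H := 1 + Yᵀ * Y with hH
  have hHu : IsUnit H.det := by
    rwa [hH, det_one_add_mul_comm, ← hGZ]
  set c := 2 * f lam (chartPoint I Z)
  -- Undoing the metric amounts to multiplying by `G` and `H`. The simplification rests on `Y H = G
  -- Y` and `Y D H = Y D - E Y + S Y`.
  have h1 : G * (c • (G⁻¹ * Y - S⁻¹ * Y * D)) * H = -(c • (G * S⁻¹ * (Y * D - E * Y))) := by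
    have h2 : Y * H = G * Y := by
      rw [hH, hGZ, Matrix.mul_add, Matrix.add_mul, Matrix.mul_assoc]; simp
    have h3 : Y * D * H = Y * D - E * Y + S * Y := by
      rw [hH, hSZ, Matrix.mul_add, Matrix.add_mul, ← Matrix.mul_assoc, Matrix.mul_one]
      abel
    rw [Matrix.mul_smul, Matrix.smul_mul, ← smul_neg]
    congr 1
    rw [Matrix.mul_sub, mul_nonsing_inv_cancel_left _ _ hG, Matrix.sub_mul, h2,
      Matrix.mul_assoc S⁻¹, Matrix.mul_assoc G, Matrix.mul_assoc S⁻¹, h3,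
      Matrix.mul_add, nonsing_inv_mul_cancel_left _ _ hS, Matrix.mul_add, Matrix.mul_assoc]
    abel
  have h4 : IsGradient lam I Z V ↔ G⁻¹ * of V * H⁻¹ = c • (G⁻¹ * Y - S⁻¹ * Y * D) := by
    rw [ext_iff_trace_mul_right]
    constructor
    · intro h W
      have := h (fun α j => W j α)
      rw [metric, fderiv_f_chartPoint hpos, ← hGZ] at this
      rw [Matrix.smul_mul, trace_smul]
      exact this
    · intro h W
      have := h (of W)ᵀ
      rw [metric, fderiv_f_chartPoint hpos, ← hGZ]
      rw [Matrix.smul_mul, trace_smul] at this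
      exact this
  rw [h4, ← h1]
  constructor
  · intro h
    rw [← h, Matrix.mul_assoc G⁻¹, mul_nonsing_inv_cancel_left _ _ hG,
      nonsing_inv_mul_cancel_right _ _ hHu]
  · intro h
    rw [h, Matrix.mul_assoc G, nonsing_inv_mul_cancel_left _ _ hG,
      mul_nonsing_inv_cancel_right _ _ hHu]

/-- In the columns of `I` the matrix `X` is the identity, so `X D - E X` vanishes there. The formula
for the free columns thus extends to the full matrix `X`. -/
theorem chartDir_neg_of_isGradient {lam : Fin n → ℝ} (hpos : ∀ j, 0 < lam j) {I : Fin m ↪o Fin n}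
    {Z V : Coord I} (h : IsGradient lam I Z V) :
    chartDir I (-V) = (2 * f lam (chartPoint I Z)) •
      (gram (chartMatrix I Z) * (scaledGram lam (chartMatrix I Z))⁻¹ *
        (chartMatrix I Z * invSqDiag lam - invSqRange lam I * chartMatrix I Z)) := by
  rw [isGradient_iff hpos, ← neg_eq_iff_eq_neg] at h
  ext α j
  rcases eq_range_or_free I j with ⟨β, rfl⟩ | ⟨i, rfl⟩
  · rw [chartDir_range, Matrix.smul_apply, mul_apply]
    rw [Finset.sum_eq_zero, smul_zero]
    intro γ _
    simp only [invSqDiag, invSqRange, Matrix.sub_apply, mul_diagonal, diagonal_mul,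
      chartMatrix_range, one_apply]
    split_ifs with h1
    · simp [h1]
    · simp
  · have h1 := congr_fun (congr_fun h α) i
    rw [chartDir_free]
    refine h1.trans ?_
    rw [Matrix.smul_apply, Matrix.smul_apply, mul_apply, mul_apply]
    congr 1
    refine Finset.sum_congr rfl fun γ _ => ?_
    simp [invSqDiag, invSqRange, invSqFree, chartMatrix_free]

/-- The term with `E` moves `X` only along its `GL(m)`-orbit and cancels in the derivative of `P`,
leaving `P' = 2 f (D Q + Q D - 2 P)` with `Q = Xᵀ S⁻¹ X`. The claim is its diagonal entry. -/
theorem hasDerivAt_weight {lam : Fin n → ℝ} (hpos : ∀ j, 0 < lam j) (l : Fin n)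
    {I : Fin m ↪o Fin n} {z : ℝ → Coord I} {V : Coord I} {t : ℝ}
    (hV : IsGradient lam I (z t) V) (hz : HasDerivAt z (-V) t) :
    HasDerivAt (fun s => weight l (chartPoint I (z s)))
      (4 * f lam (chartPoint I (z t)) *
        ((lam l ^ 2)⁻¹ * scaledWeight lam l (chartMatrix I (z t)) -
          weight l (chartPoint I (z t)))) t := by
  have hX := hasMatrixDerivAt_chartMatrix I hz
  have hG := isUnit_iff_ne_zero.2 (gram_posDef (chartMatrix_rank I (z t))).det_pos.ne'
  have hS := isUnit_iff_ne_zero.2 (scaledGram_posDef hpos (chartMatrix_rank I (z t))).det_pos.ne'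
  have hGd := hX.mul hX.transpose
  simp only [← gram_eq] at hGd
  have hP := ((hX.transpose.mul (hGd.inv hG.ne_zero)).mul hX) l l
  refine hP.congr_deriv ?_
  rw [chartDir_neg_of_isGradient hpos hV]
  set X := chartMatrix I (z t) with hXdef
  have hw : weight l (chartPoint I (z t)) = (Xᵀ * (gram X)⁻¹ * X) l l := rfl
  have hq : scaledWeight lam l X = (Xᵀ * (scaledGram lam X)⁻¹ * X) l l := by
    rw [Matrix.mul_assoc, mul_apply]
    rfl
  have hGt : (gram X)ᵀ = gram X := by rw [gram_eq, transpose_mul, transpose_transpose]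
  have hDt : (invSqDiag lam)ᵀ = invSqDiag lam := diagonal_transpose _
  have hEt : (invSqRange lam I)ᵀ = invSqRange lam I := diagonal_transpose _
  have hSt : (scaledGram lam X)ᵀ = scaledGram lam X := by
    rw [scaledGram, transpose_mul, transpose_mul, transpose_transpose, hDt, Matrix.mul_assoc]
  rw [hw, hq]
  have hgram : X * Xᵀ = gram X := (gram_eq X).symm
  have hscaled : X * invSqDiag lam * Xᵀ = scaledGram lam X := rfl
  set G := gram X
  set S := scaledGram lam X
  set D := invSqDiag lam with hD
  set E := invSqRange lam I
  set c := f lam (chartPoint I (z t))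
  set K := S⁻¹ * (X * D - E * X) with hK
  have hKt : Kᵀ = (D * Xᵀ - Xᵀ * E) * S⁻¹ := by
    rw [hK, transpose_mul, transpose_sub, transpose_mul, transpose_mul, transpose_nonsing_inv,
      hSt, hDt, hEt]
  have hXd : (2 * c) • (G * S⁻¹ * (X * D - E * X)) = G * ((2 * c) • K) := by
    rw [hK, Matrix.mul_smul, Matrix.mul_assoc]
  have hXdt : (G * ((2 * c) • K))ᵀ = (2 * c) • (Kᵀ * G) := by
    rw [transpose_mul, transpose_smul, hGt, Matrix.smul_mul]
  have e1 : K * Xᵀ * G⁻¹ = G⁻¹ - S⁻¹ * E := by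
    rw [hK, Matrix.mul_assoc S⁻¹, Matrix.sub_mul, hscaled, Matrix.mul_assoc E, hgram,
      Matrix.mul_sub, nonsing_inv_mul _ hS, Matrix.sub_mul, one_mul, ← Matrix.mul_assoc,
      mul_nonsing_inv_cancel_right _ _ hG]
  have e2 : G⁻¹ * (X * Kᵀ) = G⁻¹ - E * S⁻¹ := by
    have h := congrArg transpose e1
    simpa only [transpose_mul, transpose_sub, transpose_transpose, transpose_nonsing_inv, hGt, hSt,
      hEt] using h
  rw [hXd, hXdt]
  have total : ((2 * c) • (Kᵀ * G) * G⁻¹ + Xᵀ * -(G⁻¹ * (G * ((2 * c) • K) * Xᵀ +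
      X * ((2 * c) • (Kᵀ * G))) * G⁻¹)) * X + Xᵀ * G⁻¹ * (G * ((2 * c) • K)) =
      (2 * c) • (D * (Xᵀ * S⁻¹ * X) + Xᵀ * S⁻¹ * X * D - (Xᵀ * G⁻¹ * X + Xᵀ * G⁻¹ * X)) := by
    have a1 : (2 * c) • (Kᵀ * G) * G⁻¹ = (2 * c) • Kᵀ := by
      rw [Matrix.smul_mul, mul_nonsing_inv_cancel_right _ _ hG]
    have a2 : Xᵀ * G⁻¹ * (G * ((2 * c) • K)) = (2 * c) • (Xᵀ * K) := by
      rw [Matrix.mul_assoc, nonsing_inv_mul_cancel_left _ _ hG, Matrix.mul_smul]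
    have a3 : G⁻¹ * (G * ((2 * c) • K) * Xᵀ + X * ((2 * c) • (Kᵀ * G))) * G⁻¹ =
        (2 * c) • (G⁻¹ - S⁻¹ * E + (G⁻¹ - E * S⁻¹)) := by
      rw [← e1, ← e2, Matrix.mul_add, Matrix.mul_assoc G, nonsing_inv_mul_cancel_left _ _ hG,
        Matrix.add_mul, Matrix.smul_mul, Matrix.smul_mul, Matrix.mul_smul, Matrix.mul_smul,
        Matrix.smul_mul, smul_add, ← Matrix.mul_assoc X, ← Matrix.mul_assoc G⁻¹,
        mul_nonsing_inv_cancel_right _ _ hG]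
    rw [a1, a2, a3, hKt, hK, Matrix.mul_neg, Matrix.mul_smul, ← smul_neg, ← smul_add,
      Matrix.smul_mul, ← smul_add]
    congr 1
    simp only [Matrix.mul_add, Matrix.add_mul, Matrix.mul_sub, Matrix.sub_mul, Matrix.neg_mul,
      Matrix.mul_assoc]
    abel
  refine (congr_fun (congr_fun total l) l).trans ?_
  rw [Matrix.smul_apply, Matrix.sub_apply, Matrix.add_apply, Matrix.add_apply, hD, invSqDiag,
    diagonal_mul, mul_diagonal, smul_eq_mul]
  ring

end Chart

/-! ### Monotone functions with equal limits, and a Grönwall estimate. -/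

section RealLemmas

/-- Two functions occur because the unstable and stable manifolds each supply their own flow line
through the point; uniqueness of solutions is thereby avoided. The chain `v ≤ y₁ t ≤ y₁ 0 = y₂ 0 ≤
y₂ s ≤ v`, for `t ≤ 0 ≤ s`, collapses. -/
theorem eq_const_of_monotoneOn_of_tendsto {y₁ y₂ : ℝ → ℝ} {v : ℝ}
    (h₁ : MonotoneOn y₁ (Set.Iic 0)) (h₂ : MonotoneOn y₂ (Set.Ici 0)) (h0 : y₁ 0 = y₂ 0)
    (hbot : Tendsto y₁ atBot (𝓝 v)) (htop : Tendsto y₂ atTop (𝓝 v)) :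
    (∀ t ≤ 0, y₁ t = v) ∧ ∀ t, 0 ≤ t → y₂ t = v := by
  have a1 : ∀ t ≤ 0, v ≤ y₁ t := fun t ht =>
    le_of_tendsto hbot ((eventually_le_atBot t).mono fun s hs => h₁ (hs.trans ht) ht hs)
  have a2 : ∀ t, 0 ≤ t → y₂ t ≤ v := fun t ht =>
    ge_of_tendsto htop ((eventually_ge_atTop t).mono fun s hs => h₂ ht (ht.trans hs) hs)
  refine ⟨fun t ht => le_antisymm ?_ (a1 t ht), fun t ht => le_antisymm (a2 t ht) ?_⟩
  · exact (h₁ ht Set.self_mem_Iic ht).trans (h0.trans_le (a2 0 le_rfl))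
  · exact (a1 0 le_rfl).trans (h0.trans_le (h₂ Set.self_mem_Ici ht ht))

theorem eq_const_of_antitoneOn_of_tendsto {y₁ y₂ : ℝ → ℝ} {v : ℝ}
    (h₁ : AntitoneOn y₁ (Set.Iic 0)) (h₂ : AntitoneOn y₂ (Set.Ici 0)) (h0 : y₁ 0 = y₂ 0)
    (hbot : Tendsto y₁ atBot (𝓝 v)) (htop : Tendsto y₂ atTop (𝓝 v)) :
    (∀ t ≤ 0, y₁ t = v) ∧ ∀ t, 0 ≤ t → y₂ t = v := by
  have h := eq_const_of_monotoneOn_of_tendsto h₁.neg h₂.neg (by simp [h0]) hbot.neg htop.neg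
  simpa using h

/-- A solution of the differential inequality `y' ≤ K y` starting at `0` stays nonpositive. -/
theorem nonpos_of_deriv_le_mul {y y' : ℝ → ℝ} {K T : ℝ} (hT : 0 ≤ T)
    (hy : ∀ t, HasDerivAt y (y' t) t) (hle : ∀ t ∈ Set.Icc 0 T, y' t ≤ K * y t) (h0 : y 0 = 0) :
    y T ≤ 0 := by
  have hd : ∀ t, HasDerivAt (fun t => y t * Real.exp (-(K * t)))
      ((y' t - K * y t) * Real.exp (-(K * t))) t := by
    intro t
    have he : HasDerivAt (fun t => Real.exp (-(K * t))) (Real.exp (-(K * t)) * (-(K * 1))) t :=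
      ((hasDerivAt_id t).const_mul K).fun_neg.exp
    refine ((hy t).fun_mul he).congr_deriv ?_
    ring
  have hanti : AntitoneOn (fun t => y t * Real.exp (-(K * t))) (Set.Icc 0 T) := by
    refine antitoneOn_of_deriv_nonpos (convex_Icc 0 T)
      (fun t _ => (hd t).continuousAt.continuousWithinAt)
      (fun t _ => (hd t).differentiableAt.differentiableWithinAt) fun t ht => ?_
    rw [(hd t).deriv]
    refine mul_nonpos_of_nonpos_of_nonneg ?_ (Real.exp_pos _).le
    linarith [hle t (interior_subset ht)]
  have h := hanti (Set.left_mem_Icc.2 hT) (Set.right_mem_Icc.2 hT) hT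
  simp only [h0, zero_mul] at h
  by_contra! hpos
  exact h.not_gt (mul_pos hpos (Real.exp_pos _))

end RealLemmas

/-! ### The charts cover the Grassmannian. -/

section Charts

variable {m n : ℕ}

theorem proj_eq_chartPoint {J : Fin m ↪o Fin n} {X : FullRank m n} (hX : X ∈ U J) :
    proj X = chartPoint J fun α i => X.1 α i := by
  unfold chartPoint
  congr 1
  apply Subtype.ext
  ext α j
  change X.1 α j = chartMatrix J (fun α i => X.1 α i) α j
  rcases eq_range_or_free J j with ⟨β, rfl⟩ | ⟨i, rfl⟩
  · rw [chartMatrix_range, ← hX]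
    rfl
  · rw [chartMatrix_free]

theorem exists_eq_chartPoint {J : Fin m ↪o Fin n} {V : Gr m n} (hV : V ∈ chartDomain J) :
    ∃ Z, V = chartPoint J Z := by
  obtain ⟨X, hX, rfl⟩ := hV
  exact ⟨_, proj_eq_chartPoint hX⟩

theorem exists_isUnit_submatrix {X : Matrix (Fin m) (Fin n) ℝ} (hX : X.rank = m) :
    ∃ J : Fin m ↪o Fin n, IsUnit (X.submatrix id J) := by
  classical
  obtain ⟨κ, a, ha, hspan, hli⟩ := exists_linearIndependent' ℝ X.col
  have : Finite κ := Finite.of_injective a ha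
  have := Fintype.ofFinite κ
  have hcard : (Finset.univ.image a).card = m := by
    rw [Finset.card_image_of_injective _ ha, Finset.card_univ,
      linearIndependent_iff_card_eq_finrank_span.1 hli, Set.finrank, hspan,
      ← rank_eq_finrank_span_cols, hX]
  set J := (Finset.univ.image a).orderEmbOfFin hcard
  have hJ : ∀ α, ∃ i, a i = J α := fun α => by
    obtain ⟨i, -, hi⟩ := Finset.mem_image.1 ((Finset.univ.image a).orderEmbOfFin_mem hcard α)
    exact ⟨i, hi⟩
  choose g hg using hJ
  refine ⟨J, ?_⟩
  rw [← linearIndependent_cols_iff_isUnit]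
  have hcol : (X.submatrix id J).col = (X.col ∘ a) ∘ g := by
    ext α β
    simp [hg]
  rw [hcol]
  refine hli.comp g fun α β hαβ => J.injective ?_
  rw [← hg, ← hg, hαβ]

theorem exists_mem_chartDomain (V : Gr m n) : ∃ J, V ∈ chartDomain J := by
  induction V using Quotient.inductionOn with
  | h X =>
    obtain ⟨J, hJ⟩ := exists_isUnit_submatrix X.2
    have hdet := (isUnit_iff_isUnit_det _).1 hJ
    set A := X.1.submatrix id J
    have hY : (A⁻¹ * X.1).submatrix id J = 1 := by
      rw [← nonsing_inv_mul A hdet]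
      rfl
    have hdet' : IsUnit A⁻¹.det := isUnit_nonsing_inv_det _ hdet
    have hr : (A⁻¹ * X.1).rank = m := by
      rw [rank_mul_eq_right_of_isUnit_det _ _ hdet', X.2]
    refine ⟨J, ⟨A⁻¹ * X.1, hr⟩, hY, ?_⟩
    exact (Quotient.sound ⟨nonsingInvUnit _ hdet', rfl⟩ : proj X = proj ⟨A⁻¹ * X.1, hr⟩).symm

end Charts

/-! ### Monotonicity and vanishing of weights along flow lines. -/

section FlowLines

variable {m n : ℕ} {lam : Fin n → ℝ} {γ : ℝ → Gr m n}

/-- `scaledWeight` is evaluated on a matrix, so a representative of `γ t` is chosen; one choice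
serves all `l`. -/
theorem IsFlowLine.hasDerivAt_weight (hγ : IsFlowLine lam γ) (hpos : ∀ j, 0 < lam j) (t : ℝ) :
    ∃ X : FullRank m n, proj X = γ t ∧ ∀ l, HasDerivAt (fun s => weight l (γ s))
      (4 * f lam (γ t) * ((lam l ^ 2)⁻¹ * scaledWeight lam l X.1 - weight l (γ t))) t := by
  obtain ⟨I, hI⟩ := exists_mem_chartDomain (γ t)
  obtain ⟨z, V, hz, hV, hd⟩ := hγ t I hI
  refine ⟨⟨chartMatrix I (z t), chartMatrix_rank I (z t)⟩, hz.self_of_nhds.symm, fun l => ?_⟩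
  rw [hz.self_of_nhds]
  refine (RealGrassmann.hasDerivAt_weight hpos l hV hd).congr_of_eventuallyEq ?_
  filter_upwards [hz] with s hs
  rw [hs]

theorem IsFlowLine.continuous_f (hγ : IsFlowLine lam γ) (hpos : ∀ j, 0 < lam j) :
    Continuous fun t => f lam (γ t) := by
  refine continuous_iff_continuousAt.2 fun t => ?_
  obtain ⟨I, hI⟩ := exists_mem_chartDomain (γ t)
  obtain ⟨z, V, hz, hV, hd⟩ := hγ t I hI
  have h := (hasDerivAt_f_chartPoint hpos I hd).continuousAt
  refine h.congr ?_
  filter_upwards [hz] with s hs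
  rw [hs]

theorem weight_nonneg (l : Fin n) (V : Gr m n) : 0 ≤ weight l V := by
  obtain ⟨X, rfl⟩ := Quotient.exists_rep V
  change 0 ≤ weight l (proj X)
  rw [weight_proj_eq_sq]
  exact Finset.sum_nonneg fun j _ => mul_self_nonneg _

theorem IsFlowLine.monotoneOn_weight (hγ : IsFlowLine lam γ) (hpos : ∀ j, 0 < lam j)
    {s : Set ℝ} (hs : Convex ℝ s) {l : Fin n}
    (h : ∀ t ∈ s, ∀ j, lam j < lam l → weight j (γ t) = 0 ∨ weight j (γ t) = 1) :
    MonotoneOn (fun t => weight l (γ t)) s := by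
  refine monotoneOn_of_deriv_nonneg hs (fun t _ => ?_) (fun t _ => ?_) fun t ht => ?_
  all_goals obtain ⟨X, hX, hd⟩ := hγ.hasDerivAt_weight hpos t
  · exact (hd l).continuousAt.continuousWithinAt
  · exact (hd l).differentiableAt.differentiableWithinAt
  · rw [(hd l).deriv]
    refine mul_nonneg (mul_nonneg zero_le_four (f_pos hpos _).le) (sub_nonneg.2 ?_)
    have h' := h t (interior_subset ht)
    rw [← hX] at h' ⊢
    exact weight_le_scaledWeight hpos l X h'

theorem IsFlowLine.antitoneOn_weight (hγ : IsFlowLine lam γ) (hpos : ∀ j, 0 < lam j)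
    {s : Set ℝ} (hs : Convex ℝ s) {l : Fin n}
    (h : ∀ t ∈ s, ∀ j, lam l < lam j → weight j (γ t) = 0 ∨ weight j (γ t) = 1) :
    AntitoneOn (fun t => weight l (γ t)) s := by
  refine antitoneOn_of_deriv_nonpos hs (fun t _ => ?_) (fun t _ => ?_) fun t ht => ?_
  all_goals obtain ⟨X, hX, hd⟩ := hγ.hasDerivAt_weight hpos t
  · exact (hd l).continuousAt.continuousWithinAt
  · exact (hd l).differentiableAt.differentiableWithinAt
  · rw [(hd l).deriv]
    refine mul_nonpos_of_nonneg_of_nonpos (mul_nonneg zero_le_four (f_pos hpos _).le)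
      (sub_nonpos.2 ?_)
    have h' := h t (interior_subset ht)
    rw [← hX] at h' ⊢
    exact scaledWeight_le_weight hpos l l X fun j hj => ⟨fun e => hj.ne (by rw [e]), h' j hj⟩

/-- A weight which vanishes at some time vanishes at all later times. -/
theorem IsFlowLine.weight_eq_zero_of_le (hγ : IsFlowLine lam γ) (hpos : ∀ j, 0 < lam j)
    {l : Fin n} (h0 : weight l (γ 0) = 0) {T : ℝ} (hT : 0 ≤ T) : weight l (γ T) = 0 := by
  have : Nonempty (Fin n) := ⟨l⟩
  obtain ⟨r, hr⟩ := Finite.exists_max lam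
  choose X hX hd using hγ.hasDerivAt_weight hpos
  obtain ⟨B, hB⟩ := (isCompact_Icc (a := (0 : ℝ)) (b := T)).bddAbove_image
    (hγ.continuous_f hpos).continuousOn
  refine le_antisymm ?_ (weight_nonneg _ _)
  -- The constant comes from `f ≤ B` on the compact time interval and `q_l ≤ λ_r² w_l`, with `λ_r`
  -- the largest `λ`.
  refine nonpos_of_deriv_le_mul (K := 4 * B * ((lam l ^ 2)⁻¹ * lam r ^ 2)) hT (fun t => hd t l)
    (fun t ht => ?_) h0
  have hBt : f lam (γ t) ≤ B := hB ⟨t, ht, rfl⟩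
  have hw := scaledWeight_le_weight hpos l r (X t) fun j hj => absurd (hr j) hj.not_ge
  rw [hX] at hw
  have hf := (f_pos hpos (γ t)).le
  have hp := weight_nonneg l (γ t)
  have hr2 : 0 < lam r ^ 2 := pow_pos (hpos r) 2
  have hl2 : 0 < (lam l ^ 2)⁻¹ := inv_pos.2 (pow_pos (hpos l) 2)
  have hq : scaledWeight lam l (X t).1 ≤ lam r ^ 2 * weight l (γ t) := by
    rwa [inv_mul_le_iff₀ hr2] at hw
  calc _ ≤ 4 * f lam (γ t) * ((lam l ^ 2)⁻¹ * (lam r ^ 2 * weight l (γ t))) := by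
        refine mul_le_mul_of_nonneg_left ?_ (by positivity)
        have := mul_le_mul_of_nonneg_left hq hl2.le
        linarith
    _ ≤ 4 * B * ((lam l ^ 2)⁻¹ * (lam r ^ 2 * weight l (γ t))) := by gcongr
    _ = _ := by ring

/-- A weight which vanishes at some time vanishes at all earlier times. -/
theorem IsFlowLine.weight_eq_zero_of_ge (hγ : IsFlowLine lam γ) (hpos : ∀ j, 0 < lam j)
    {l : Fin n} (h0 : weight l (γ 0) = 0) {T : ℝ} (hT : 0 ≤ T) : weight l (γ (-T)) = 0 := by
  choose X hX hd using hγ.hasDerivAt_weight hpos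
  obtain ⟨B, hB⟩ := (isCompact_Icc (a := -T) (b := 0)).bddAbove_image
    (hγ.continuous_f hpos).continuousOn
  refine le_antisymm ?_ (weight_nonneg _ _)
  -- After time reversal the term with `q_l ≥ 0` has a favourable sign and is dropped, leaving `y' ≤
  -- 4 B y`.
  refine nonpos_of_deriv_le_mul (y := fun t => weight l (γ (-t))) (K := 4 * B) hT
    (fun t => (hd (-t) l).scomp t (hasDerivAt_neg t)) (fun t ht => ?_) (by simpa using h0)
  have hBt : f lam (γ (-t)) ≤ B := hB ⟨-t, ⟨neg_le_neg ht.2, neg_nonpos.2 ht.1⟩, rfl⟩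
  have hf := (f_pos hpos (γ (-t))).le
  have hp := weight_nonneg l (γ (-t))
  have hq := mul_nonneg (inv_pos.2 (pow_pos (hpos l) 2)).le (scaledWeight_nonneg hpos l (X (-t)))
  have h1 := mul_nonneg hf hq
  have h2 := mul_le_mul_of_nonneg_right hBt hp
  rw [smul_eq_mul]
  linarith

end FlowLines

/-! ### Coordinate axes and their characterization by weights. -/

section Axis

variable {m n : ℕ}

/-- The point of the coordinate space of a chart with at most one nonzero coordinate. -/
def axis (I : Fin m ↪o Fin n) (k : Fin m) (i : Free I) (x : ℝ) : Coord I :=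
  fun α l => Matrix.single k i x α l

theorem of_axis (I : Fin m ↪o Fin n) (k : Fin m) (i : Free I) (x : ℝ) :
    of (axis I k i x) = Matrix.single k i x := rfl

theorem axis_zero (I : Fin m ↪o Fin n) (k : Fin m) (i : Free I) : axis I k i 0 = 0 := by
  ext α l
  simp [axis]

theorem chartMatrix_axis (I : Fin m ↪o Fin n) (k : Fin m) (i : Free I) (x : ℝ) (α : Fin m)
    (l : Fin n) : chartMatrix I (axis I k i x) α l =
      (if l = I α then 1 else 0) + if α = k ∧ l = i then x else 0 := by
  rcases eq_range_or_free I l with ⟨β, rfl⟩ | ⟨l, rfl⟩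
  · rw [chartMatrix_range, one_apply, if_neg (c := α = k ∧ I β = i) (fun h => i.2 β h.2)]
    simp [eq_comm]
  · rw [chartMatrix_free, if_neg (fun h => l.2 α h.symm), zero_add, axis, single_apply]
    simp [Subtype.ext_iff, eq_comm]

theorem mem_puncturedAxis_iff {I : Fin m ↪o Fin n} {k : Fin m} {i : Free I} {V : Gr m n} :
    V ∈ puncturedAxis I k i ↔ ∃ x, x ≠ 0 ∧ V = chartPoint I (axis I k i x) := by
  constructor
  · rintro ⟨X, ⟨hU, hne, hz⟩, rfl⟩
    refine ⟨X.1 k i, hne, ?_⟩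
    rw [proj_eq_chartPoint hU]
    congr 1
    ext α l
    rw [axis, single_apply]
    split_ifs with h
    · rw [h.1, h.2]
    · refine hz α l fun e => h ?_
      rw [Prod.mk.injEq] at e
      exact ⟨e.1.symm, Subtype.ext e.2.symm⟩
  · rintro ⟨x, hx, rfl⟩
    refine ⟨⟨chartMatrix I (axis I k i x), chartMatrix_rank I _⟩,
      ⟨chartMatrix_submatrix I _, ?_, fun α l h => ?_⟩, rfl⟩
    · change chartMatrix I (axis I k i x) k i ≠ 0
      rw [chartMatrix_free, axis, single_apply_same]
      exact hx
    · change chartMatrix I (axis I k i x) α l = 0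
      rw [chartMatrix_free, axis, single_apply, if_neg]
      rintro ⟨rfl, rfl⟩
      exact h rfl

/-- The nonzero points of a coordinate axis seen in the chart where the index `I k` is exchanged
with the index of the axis. -/
theorem chartPoint_axis_eq {I L : Fin m ↪o Fin n} {k : Fin m} {i : Free I} {j : Free L}
    (hi : (i : Fin n) = L k) (hj : (j : Fin n) = I k) (hne : ∀ α, α ≠ k → L α = I α) {x : ℝ}
    (hx : x ≠ 0) : chartPoint I (axis I k i x) = chartPoint L (axis L k j x⁻¹) := by
  have hdet : IsUnit (diagonal fun α : Fin m => if α = k then x⁻¹ else 1).det := by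
    rw [det_diagonal, isUnit_iff_ne_zero, Finset.prod_ne_zero_iff]
    intro α _
    split_ifs
    · exact inv_ne_zero hx
    · exact one_ne_zero
  -- Row `k` is `e_{I k} + x e_{L k}`; dividing it by `x` gives `e_{L k} + x⁻¹ e_{I k}`, the axis
  -- row in the chart of `L`.
  refine Quotient.sound ⟨nonsingInvUnit _ hdet, ?_⟩
  change chartMatrix L (axis L k j x⁻¹) =
    (diagonal fun α : Fin m => if α = k then x⁻¹ else 1) * chartMatrix I (axis I k i x)
  ext α l
  rw [diagonal_mul, chartMatrix_axis, chartMatrix_axis, hi, hj]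
  by_cases h : α = k
  · subst h
    have hLI : L α ≠ I α := fun e => i.2 α (by rw [hi, e])
    by_cases h1 : l = L α
    · simp [h1, hLI, hx]
    · by_cases h2 : l = I α <;> simp [h1, h2, hLI.symm]
  · simp [h, hne α h]

theorem weight_eq_one_of_row {X : FullRank m n} {α : Fin m} {j : Fin n}
    (h : X.1.row α = Pi.single j 1) : weight j (proj X) = 1 :=
  weight_eq_one_of_vecMul (c := Pi.single α 1) (by rw [single_one_vecMul]; exact h)

theorem weight_axis_range {I : Fin m ↪o Fin n} {k α : Fin m} (hα : α ≠ k) (i : Free I) (x : ℝ) :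
    weight (I α) (chartPoint I (axis I k i x)) = 1 := by
  refine weight_eq_one_of_row (α := α) ?_
  ext l
  change chartMatrix I (axis I k i x) α l = _
  rw [chartMatrix_axis, Pi.single_apply]
  simp [hα]

theorem weight_axis_free {I : Fin m ↪o Fin n} {k : Fin m} {i j : Free I} (hj : j ≠ i) (x : ℝ) :
    weight j (chartPoint I (axis I k i x)) = 0 := by
  refine weight_eq_zero_of_col ?_
  ext α
  change chartMatrix I (axis I k i x) α j = 0
  rw [chartMatrix_free, axis, single_apply, if_neg fun h => hj h.2.symm]

theorem weight_O_range (I : Fin m ↪o Fin n) (α : Fin m) : weight (I α) (O I) = 1 := by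
  refine weight_eq_one_of_row (α := α) ?_
  ext l
  change chartMatrix I 0 α l = _
  rcases eq_range_or_free I l with ⟨β, rfl⟩ | ⟨l, rfl⟩
  · rw [chartMatrix_range, one_apply, Pi.single_apply]
    simp [eq_comm]
  · rw [chartMatrix_free, Pi.single_eq_of_ne (l.2 α).symm]
    rfl

theorem weight_O_free (I : Fin m ↪o Fin n) (j : Free I) : weight j (O I) = 0 := by
  refine weight_eq_zero_of_col ?_
  ext α
  change chartMatrix I 0 α j = 0
  rw [chartMatrix_free]
  rfl

theorem eq_of_range_subset {I J : Fin m ↪o Fin n} (h : Set.range J ⊆ Set.range I) : J = I := by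
  have hr : Set.range J = Set.range I := by
    refine Set.eq_of_subset_of_ncard_le h ?_ (Set.finite_range I)
    rw [← Set.image_univ, ← Set.image_univ, Set.ncard_image_of_injective _ I.injective,
      Set.ncard_image_of_injective _ J.injective]
  have := (StrictMono.range_inj J.strictMono I.strictMono).1 hr
  exact DFunLike.coe_injective this

/-- Weight one puts `e_j` in the row space. If `J` misses `j`, the identity block in the columns `J`
forces all coefficients of `e_j` to vanish. -/
theorem exists_range_of_weight_eq_one {J : Fin m ↪o Fin n} {V : Gr m n} (hV : V ∈ chartDomain J)
    {j : Fin n} (h : weight j V = 1) : ∃ α, J α = j := by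
  obtain ⟨X, hX, rfl⟩ := hV
  obtain ⟨c, hc⟩ := exists_vecMul_of_weight h
  by_contra! hj
  have hc0 : c = 0 := by
    have h1 : c ᵥ* X.1.submatrix id J = 0 := by
      ext α
      change (c ᵥ* X.1) (J α) = 0
      rw [hc, Pi.single_eq_of_ne (hj α)]
    rwa [show X.1.submatrix id J = 1 from hX, vecMul_one] at h1
  rw [hc0, zero_vecMul] at hc
  simpa using congr_fun hc j

theorem weight_ne_zero_of_mem_chartDomain {J : Fin m ↪o Fin n} {V : Gr m n}
    (hV : V ∈ chartDomain J) (α : Fin m) : weight (J α) V ≠ 0 := by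
  obtain ⟨X, hX, rfl⟩ := hV
  intro h
  have h1 := congr_fun (col_eq_zero_of_weight h) α
  have h2 := congr_fun (congr_fun (show X.1.submatrix id J = 1 from hX) α) α
  simp only [col_apply, Pi.zero_apply] at h1
  simp [h1] at h2

/-- A chart index must contain every index of weight 1 and avoid every index of weight 0, which
leaves only the choice between `I k` and `L k`. Flow lines are tested in all charts around a point,
so this reduces the test to two. -/
theorem eq_or_eq_of_mem_chartDomain {I L J : Fin m ↪o Fin n} {k : Fin m}
    (hne : ∀ α, α ≠ k → L α = I α) {V : Gr m n} (h1 : ∀ α, α ≠ k → weight (I α) V = 1)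
    (h0 : ∀ j, (∀ α, I α ≠ j) → j ≠ L k → weight j V = 0) (hV : V ∈ chartDomain J) :
    J = I ∨ J = L := by
  by_cases hL : ∃ β, J β = L k
  · right
    refine (eq_of_range_subset ?_).symm
    rintro _ ⟨α, rfl⟩
    by_cases hα : α = k
    · rwa [hα]
    · rw [hne α hα]
      exact exists_range_of_weight_eq_one hV (h1 α hα)
  · left
    refine eq_of_range_subset ?_
    rintro _ ⟨α, rfl⟩
    by_contra hα
    exact weight_ne_zero_of_mem_chartDomain hV α
      (h0 (J α) (fun β hβ => hα ⟨β, hβ⟩) fun e => hL ⟨α, e⟩)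

/-- Weight 0 kills a free column; weight 1 at `I α` forces row `α` to be the basis vector `e_{I α}`.
-/
theorem eq_axis_of_weight {I : Fin m ↪o Fin n} {k : Fin m} {i : Free I} {Z : Coord I}
    (h1 : ∀ α, α ≠ k → weight (I α) (chartPoint I Z) = 1)
    (h0 : ∀ j : Free I, j ≠ i → weight j (chartPoint I Z) = 0) : Z = axis I k i (Z k i) := by
  ext α l
  rw [axis, single_apply]
  by_cases hl : l = i
  · by_cases hα : α = k
    · rw [if_pos ⟨hα.symm, hl.symm⟩, hα, hl]
    · rw [if_neg fun h => hα h.1.symm]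
      obtain ⟨c, hc⟩ := exists_vecMul_of_weight (h1 α hα)
      change c ᵥ* chartMatrix I Z = _ at hc
      have hc1 : c = Pi.single α 1 := by
        have h : c ᵥ* (chartMatrix I Z).submatrix id I = Pi.single α 1 := by
          ext β
          change (c ᵥ* chartMatrix I Z) (I β) = _
          rw [hc, Pi.single_apply, Pi.single_apply]
          simp
        rwa [chartMatrix_submatrix, vecMul_one] at h
      rw [hc1, single_one_vecMul] at hc
      have h := congr_fun hc l
      rw [Pi.single_eq_of_ne (l.2 α).symm] at h
      rw [← h]
      exact (chartMatrix_free I Z α l).symm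
  · rw [if_neg fun h => hl h.2.symm, ← chartMatrix_free I Z α l]
    exact congr_fun (col_eq_zero_of_weight (h0 l hl)) α

end Axis

/-! ### The flow along a coordinate axis. -/

section AxisFlow

variable {m n : ℕ} {lam : Fin n → ℝ}

/-- The velocity of the flow along a coordinate axis of a chart. -/
noncomputable def axisVelocity (lam : Fin n → ℝ) (I : Fin m ↪o Fin n) (k : Fin m) (i : Free I)
    (x : ℝ) : ℝ :=
  2 * f lam (chartPoint I (axis I k i x)) * ((1 + x ^ 2) /
    ((lam (I k) ^ 2)⁻¹ + (lam i ^ 2)⁻¹ * x ^ 2)) * ((lam i ^ 2)⁻¹ - (lam (I k) ^ 2)⁻¹) * x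

theorem single_mul_invSqFree (I : Fin m ↪o Fin n) (k : Fin m) (i : Free I) (x : ℝ) :
    single k i x * invSqFree lam I = (lam i ^ 2)⁻¹ • single k i x := by
  ext α l
  rw [invSqFree, mul_diagonal, Matrix.smul_apply, single_apply]
  split_ifs with h
  · rw [h.2, smul_eq_mul, mul_comm]
  · simp

theorem invSqRange_mul_single (I : Fin m ↪o Fin n) (k : Fin m) (i : Free I) (x : ℝ) :
    invSqRange lam I * single k i x = (lam (I k) ^ 2)⁻¹ • single k i x := by
  ext α l
  rw [invSqRange, diagonal_mul, Matrix.smul_apply, single_apply]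
  split_ifs with h
  · rw [h.1, smul_eq_mul]
  · simp

/-- A matrix with a single nonzero entry is an eigenvector of every factor in the gradient formula,
so the gradient stays on the axis. -/
theorem isGradient_axis (hpos : ∀ j, 0 < lam j) (I : Fin m ↪o Fin n) (k : Fin m) (i : Free I)
    (x : ℝ) : IsGradient lam I (axis I k i x) (axis I k i (-axisVelocity lam I k i x)) := by
  rw [isGradient_iff hpos, of_axis, of_axis, single_mul_invSqFree, invSqRange_mul_single]
  set X := chartMatrix I (axis I k i x) with hX
  have hS := isUnit_iff_ne_zero.2
    (scaledGram_posDef hpos (chartMatrix_rank I (axis I k i x))).det_pos.ne'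
  have hG : gram X * single k i x = (1 + x ^ 2) • single k i x := by
    rw [hX, gram_chartMatrix, of_axis, transpose_single, single_mul_single_same, Matrix.add_mul,
      single_mul_single_same, add_smul, one_smul, Matrix.one_mul, smul_single]
    congr 2
    simp [pow_two]
  have hSZ : scaledGram lam X * single k i x =
      ((lam (I k) ^ 2)⁻¹ + (lam i ^ 2)⁻¹ * x ^ 2) • single k i x := by
    rw [hX, scaledGram_chartMatrix, of_axis, single_mul_invSqFree, Matrix.add_mul,
      invSqRange_mul_single, transpose_single, Matrix.smul_mul, single_mul_single_same,
      Matrix.smul_mul, single_mul_single_same, add_smul, smul_single, smul_single]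
    congr 2
    simp [pow_two, mul_assoc]
  have hs : (lam (I k) ^ 2)⁻¹ + (lam i ^ 2)⁻¹ * x ^ 2 ≠ 0 := by
    have h1 := hpos (I k)
    have h2 := hpos i
    positivity
  have hSi : (scaledGram lam X)⁻¹ * single k i x =
      ((lam (I k) ^ 2)⁻¹ + (lam i ^ 2)⁻¹ * x ^ 2)⁻¹ • single k i x := by
    rw [eq_inv_smul_iff₀ hs, ← Matrix.mul_smul, ← hSZ, nonsing_inv_mul_cancel_left _ _ hS]
  rw [← sub_smul, Matrix.mul_smul, Matrix.mul_assoc, hSi, Matrix.mul_smul, hG, ← neg_smul]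
  simp only [smul_single, smul_eq_mul]
  congr 1
  rw [axisVelocity]
  ring

theorem hasDerivAt_axis (I : Fin m ↪o Fin n) (k : Fin m) (i : Free I) {x : ℝ → ℝ} {x' t : ℝ}
    (hx : HasDerivAt x x' t) : HasDerivAt (fun s => axis I k i (x s)) (axis I k i x') t := by
  refine hasDerivAt_pi.2 fun α => hasDerivAt_pi.2 fun l => ?_
  simp only [axis, single_apply]
  split_ifs
  · exact hx
  · exact hasDerivAt_const t _

theorem neg_axis (I : Fin m ↪o Fin n) (k : Fin m) (i : Free I) (x : ℝ) :
    -axis I k i (-x) = axis I k i x := by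
  ext α l
  simp only [axis, Pi.neg_apply, single_apply]
  split_ifs <;> simp

/-- Along a coordinate axis `f` is a constant multiple of a quotient of quadratic polynomials. -/
theorem exists_f_axis (hpos : ∀ j, 0 < lam j) (I : Fin m ↪o Fin n) (k : Fin m) (i : Free I) :
    ∃ C, 0 < C ∧ ∀ x, f lam (chartPoint I (axis I k i x)) =
      C * ((1 + x ^ 2) / ((lam (I k) ^ 2)⁻¹ + (lam i ^ 2)⁻¹ * x ^ 2)) := by
  refine ⟨(∏ α ∈ Finset.univ \ {k}, (lam (I α) ^ 2)⁻¹)⁻¹, ?_, fun x => ?_⟩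
  · exact inv_pos.2 (Finset.prod_pos fun α _ => inv_pos.2 (pow_pos (hpos _) 2))
  · have hf : f lam (chartPoint I (axis I k i x)) = (gram (chartMatrix I (axis I k i x))).det /
        (scaledGram lam (chartMatrix I (axis I k i x))).det :=
      f_proj lam ⟨_, chartMatrix_rank I _⟩
    have hG : gram (chartMatrix I (axis I k i x)) =
        diagonal (Function.update (fun _ => 1) k (1 + x ^ 2)) := by
      rw [gram_chartMatrix, of_axis, transpose_single, single_mul_single_same]
      ext α β
      rw [Matrix.add_apply, one_apply, single_apply, diagonal_apply, Function.update_apply]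
      by_cases h : α = β
      · subst h
        by_cases h' : α = k
        · simp [h', pow_two]
        · simp [h', Ne.symm h']
      · simp only [h, if_false, zero_add]
        rw [if_neg]
        rintro ⟨rfl, rfl⟩
        exact h rfl
    have hS : scaledGram lam (chartMatrix I (axis I k i x)) =
        diagonal (Function.update (fun α => (lam (I α) ^ 2)⁻¹) k
          ((lam (I k) ^ 2)⁻¹ + (lam i ^ 2)⁻¹ * x ^ 2)) := by
      rw [scaledGram_chartMatrix, of_axis, single_mul_invSqFree, transpose_single, smul_single,
        single_mul_single_same, invSqRange]
      ext α β
      rw [Matrix.add_apply, single_apply, diagonal_apply, diagonal_apply, Function.update_apply]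
      by_cases h : α = β
      · subst h
        by_cases h' : α = k
        · simp [h', pow_two, mul_assoc]
        · simp [h', Ne.symm h']
      · simp only [h, if_false, zero_add]
        rw [if_neg]
        rintro ⟨rfl, rfl⟩
        exact h rfl
    rw [hf, hG, hS, det_diagonal, det_diagonal, Finset.prod_update_of_mem (Finset.mem_univ k),
      Finset.prod_update_of_mem (Finset.mem_univ k), Finset.prod_const_one]
    field_simp

theorem continuous_chartPoint (I : Fin m ↪o Fin n) : Continuous (chartPoint I) := by
  refine continuous_proj.comp (Continuous.subtype_mk ?_ _)
  refine continuous_matrix fun α j => ?_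
  rcases eq_range_or_free I j with ⟨β, rfl⟩ | ⟨i, rfl⟩
  · simp only [chartMatrix_range]
    fun_prop
  · simp only [chartMatrix_free]
    fun_prop

theorem tendsto_chartPoint_axis (I : Fin m ↪o Fin n) (k : Fin m) (i : Free I) {x : ℝ → ℝ}
    {l : Filter ℝ} (hx : Tendsto x l (𝓝 0)) :
    Tendsto (fun t => chartPoint I (axis I k i (x t))) l (𝓝 (O I)) := by
  have hc : Continuous fun x => axis I k i x := by
    refine continuous_pi fun α => continuous_pi fun l => ?_
    simp only [axis, single_apply]
    split_ifs <;> fun_prop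
  have h := (((continuous_chartPoint I).comp hc).tendsto 0).comp hx
  rwa [Function.comp_apply, axis_zero] at h

/-- The flow along an axis, seen in the exchanged chart. -/
theorem axisVelocity_inv {I L : Fin m ↪o Fin n} {k : Fin m} {i : Free I} {j : Free L}
    (hi : (i : Fin n) = L k) (hj : (j : Fin n) = I k) (hne : ∀ α, α ≠ k → L α = I α)
    (hpos : ∀ j, 0 < lam j) {x : ℝ} (hx : x ≠ 0) :
    -axisVelocity lam I k i x / x ^ 2 = axisVelocity lam L k j x⁻¹ := by
  have h1 := hpos (I k)
  have h2 := hpos i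
  have hs : (lam (I k) ^ 2)⁻¹ + (lam i ^ 2)⁻¹ * x ^ 2 ≠ 0 := by positivity
  have hs' : (lam i ^ 2)⁻¹ + (lam (I k) ^ 2)⁻¹ * x⁻¹ ^ 2 ≠ 0 := by positivity
  rw [axisVelocity, axisVelocity, ← chartPoint_axis_eq hi hj hne hx, ← hi, hj]
  generalize f lam (chartPoint I (axis I k i x)) = c at *
  generalize (lam (I k) ^ 2)⁻¹ = p at *
  generalize (lam i ^ 2)⁻¹ = q at *
  have hq : q + p * x⁻¹ ^ 2 = (p + q * x ^ 2) / x ^ 2 := by field_simp; ring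
  rw [hq]
  field_simp
  ring

/-- With `s = log x²`, `p = λ_{I k}⁻²` and `q = λ_i⁻²`, the equation becomes `s' = 4 C (q - p) ((1 +
eˢ)/(p + q eˢ))²`. Since `p < q`, the right side is positive and bounded, so `s` runs over all of
`ℝ`; the sign of `x` is that of `x₀`. -/
theorem exists_axis_solution (hpos : ∀ j, 0 < lam j) (I : Fin m ↪o Fin n) (k : Fin m)
    (i : Free I) (hlt : lam i < lam (I k)) {x₀ : ℝ} (hx₀ : x₀ ≠ 0) :
    ∃ x : ℝ → ℝ, x 0 = x₀ ∧ (∀ t, x t ≠ 0) ∧ (∀ t, HasDerivAt x (axisVelocity lam I k i (x t)) t) ∧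
      Tendsto x atBot (𝓝 0) ∧ Tendsto (fun t => (x t)⁻¹) atTop (𝓝 0) := by
  obtain ⟨C, hC, hf⟩ := exists_f_axis hpos I k i
  have hv : ∀ x, axisVelocity lam I k i x = 2 * (C * ((1 + x ^ 2) /
      ((lam (I k) ^ 2)⁻¹ + (lam i ^ 2)⁻¹ * x ^ 2))) * ((1 + x ^ 2) /
    ((lam (I k) ^ 2)⁻¹ + (lam i ^ 2)⁻¹ * x ^ 2)) * ((lam i ^ 2)⁻¹ - (lam (I k) ^ 2)⁻¹) * x :=
    fun x => by rw [axisVelocity, hf]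
  have hp : 0 < (lam (I k) ^ 2)⁻¹ := inv_pos.2 (pow_pos (hpos _) 2)
  have hpq : (lam (I k) ^ 2)⁻¹ < (lam i ^ 2)⁻¹ :=
    inv_strictAnti₀ (pow_pos (hpos _) 2) (pow_lt_pow_left₀ hlt (hpos _).le two_ne_zero)
  generalize (lam (I k) ^ 2)⁻¹ = p at *
  generalize (lam i ^ 2)⁻¹ = q at *
  have hq : 0 < q := hp.trans hpq
  have hκ : 0 < 4 * C * (q - p) := by have := sub_pos.2 hpq; positivity
  obtain ⟨s, hs0, hsd, htop, hbot⟩ := exists_global_solution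
    (fun s => ((p + q * Real.exp s) / (1 + Real.exp s)) ^ 2 / (4 * C * (q - p)))
    (by
      refine Continuous.div_const (Continuous.pow (Continuous.div ?_ ?_ fun s => ?_) 2) _
      · fun_prop
      · fun_prop
      · positivity)
    -- The average `(p + q eˢ)/(1 + eˢ)` of `p` and `q` is at least `p`.
    (c := p ^ 2 / (4 * C * (q - p))) (by positivity)
    (fun s => by
      have h1 : p ≤ (p + q * Real.exp s) / (1 + Real.exp s) := by
        rw [le_div_iff₀ (by positivity)]
        nlinarith [Real.exp_pos s]
      gcongr) (Real.log (x₀ ^ 2))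
  have hsq : ∀ t, (x₀ * Real.exp ((s t - Real.log (x₀ ^ 2)) / 2)) ^ 2 = Real.exp (s t) := by
    intro t
    rw [mul_pow, ← Real.exp_nat_mul]
    have h1 : ((2 : ℕ) : ℝ) * ((s t - Real.log (x₀ ^ 2)) / 2) = s t - Real.log (x₀ ^ 2) := by
      push_cast
      ring
    rw [h1, Real.exp_sub, Real.exp_log (by positivity)]
    field_simp
  refine ⟨fun t => x₀ * Real.exp ((s t - Real.log (x₀ ^ 2)) / 2), ?_, fun t => ?_, fun t => ?_,
    ?_, ?_⟩
  · simp [hs0]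
  · exact mul_ne_zero hx₀ (Real.exp_pos _).ne'
  · have h1 := ((((hsd t).sub_const (Real.log (x₀ ^ 2))).div_const 2).exp).const_mul x₀
    refine h1.congr_deriv ?_
    rw [hv, hsq]
    have h2 : p + q * Real.exp (s t) ≠ 0 := by positivity
    have h3 : 1 + Real.exp (s t) ≠ 0 := by positivity
    field_simp
    ring
  · have h1 : Tendsto (fun t => (s t - Real.log (x₀ ^ 2)) / 2) atBot atBot :=
      (tendsto_atBot_add_const_right _ _ hbot).atBot_div_const two_pos
    simpa using (Real.tendsto_exp_atBot.comp h1).const_mul x₀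
  · have h1 : Tendsto (fun t => (s t - Real.log (x₀ ^ 2)) / 2) atTop atTop :=
      (tendsto_atTop_add_const_right _ _ htop).atTop_div_const two_pos
    have h2 := ((Real.tendsto_exp_atTop.comp h1).inv_tendsto_atTop).const_mul x₀⁻¹
    simpa [mul_inv, mul_comm] using h2

end AxisFlow

/-! ### Connecting orbits from `O_I` to `O_L`. -/

section Main

variable {m n : ℕ} {lam : Fin n → ℝ} {I L : Fin m ↪o Fin n} {k : Fin m}

theorem chartPoint_axis_mem_Wu_inter_Ws (hpos : ∀ j, 0 < lam j) {i : Free I} {j : Free L}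
    (hi : (i : Fin n) = L k) (hj : (j : Fin n) = I k) (hne : ∀ α, α ≠ k → L α = I α)
    (hlt : lam i < lam (I k)) {x₀ : ℝ} (hx₀ : x₀ ≠ 0) :
    chartPoint I (axis I k i x₀) ∈ Wu lam (O I) ∩ Ws lam (O L) := by
  obtain ⟨x, hx0, hxne, hxd, hbot, htop⟩ := exists_axis_solution hpos I k i hlt hx₀
  have hswap : ∀ t, chartPoint I (axis I k i (x t)) = chartPoint L (axis L k j (x t)⁻¹) :=
    fun t => chartPoint_axis_eq hi hj hne (hxne t)
  have hflow : IsFlowLine lam fun t => chartPoint I (axis I k i (x t)) := by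
    intro t J hJ
    have hJ' := eq_or_eq_of_mem_chartDomain hne (fun α hα => weight_axis_range hα i (x t))
      (fun l hl hlk => weight_axis_free (j := ⟨l, hl⟩) (fun e => hlk (by rw [← hi, ← e])) (x t)) hJ
    rcases hJ' with rfl | rfl
    · refine ⟨fun s => axis J k i (x s), axis J k i (-axisVelocity lam J k i (x t)),
        Eventually.of_forall fun s => rfl, isGradient_axis hpos J k i (x t), ?_⟩
      rw [neg_axis]
      exact hasDerivAt_axis J k i (hxd t)
    · refine ⟨fun s => axis J k j (x s)⁻¹, axis J k j (-axisVelocity lam J k j (x t)⁻¹),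
        Eventually.of_forall hswap, isGradient_axis hpos J k j (x t)⁻¹, ?_⟩
      rw [neg_axis, ← axisVelocity_inv hi hj hne hpos (hxne t)]
      exact hasDerivAt_axis J k j ((hxd t).fun_inv (hxne t))
  have h0 : chartPoint I (axis I k i (x 0)) = chartPoint I (axis I k i x₀) := by rw [hx0]
  refine ⟨⟨_, hflow, h0, tendsto_chartPoint_axis I k i hbot⟩, ⟨_, hflow, h0, ?_⟩⟩
  simp only [hswap]
  exact tendsto_chartPoint_axis L k j htop

theorem weight_O_eq_zero_or_one (I : Fin m ↪o Fin n) (l : Fin n) :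
    weight l (O I) = 0 ∨ weight l (O I) = 1 := by
  rcases eq_range_or_free I l with ⟨α, rfl⟩ | ⟨l, rfl⟩
  · exact Or.inr (weight_O_range I α)
  · exact Or.inl (weight_O_free I l)

theorem weight_O_eq_weight_O (hne : ∀ α, α ≠ k → L α = I α) {l : Fin n} (hlI : l ≠ I k)
    (hlL : l ≠ L k) : weight l (O L) = weight l (O I) := by
  rcases eq_range_or_free I l with ⟨α, rfl⟩ | ⟨l, rfl⟩
  · have hα : α ≠ k := fun e => hlI (by rw [e])
    rw [weight_O_range, ← hne α hα, weight_O_range]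
  · have hl : ∀ α, L α ≠ l := fun α e => by
      by_cases hα : α = k
      · exact hlL (by rw [← e, hα])
      · exact l.2 α (by rw [← hne α hα, e])
    rw [weight_O_free I l]
    exact weight_O_free L ⟨l, hl⟩

/-- Along the two halves of a connecting orbit, the weights of all indices except the exchanged
ones are constant. -/
theorem weight_eq_of_connecting (hpos : ∀ j, 0 < lam j) (hmono : StrictMono lam)
    (hk : (L k : ℕ) + 1 = (I k : ℕ)) (hne : ∀ α, α ≠ k → L α = I α) {γ₁ γ₂ : ℝ → Gr m n}
    (h₁ : IsFlowLine lam γ₁) (h₂ : IsFlowLine lam γ₂) (h0 : γ₁ 0 = γ₂ 0)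
    (hbot : Tendsto γ₁ atBot (𝓝 (O I))) (htop : Tendsto γ₂ atTop (𝓝 (O L))) {l : Fin n}
    (hlI : l ≠ I k) (hlL : l ≠ L k) :
    (∀ t ≤ 0, weight l (γ₁ t) = weight l (O I)) ∧
      ∀ t, 0 ≤ t → weight l (γ₂ t) = weight l (O I) := by
  have hb : ∀ l, Tendsto (fun t => weight l (γ₁ t)) atBot (𝓝 (weight l (O I))) :=
    fun l => ((continuous_weight l).tendsto _).comp hbot
  have ht : ∀ l, l ≠ I k → l ≠ L k →
      Tendsto (fun t => weight l (γ₂ t)) atTop (𝓝 (weight l (O I))) := fun l hI hL => by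
    rw [← weight_O_eq_weight_O hne hI hL]
    exact ((continuous_weight l).tendsto _).comp htop
  have hstart : ∀ l, weight l (γ₁ 0) = weight l (γ₂ 0) := fun l => by rw [h0]
  -- Induction upward: once all smaller weights are frozen at 0 or 1, the weight of `l` is monotone
  -- with equal limits at both ends.
  have hlow : ∀ l, l < L k → (∀ t ≤ 0, weight l (γ₁ t) = weight l (O I)) ∧
      ∀ t, 0 ≤ t → weight l (γ₂ t) = weight l (O I) := by
    intro l
    induction l using WellFoundedLT.induction with
    | ind l ih =>
      intro hl
      have hlI' : l ≠ I k := fun e => by rw [e, Fin.lt_def] at hl; omega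
      refine eq_const_of_monotoneOn_of_tendsto
        (h₁.monotoneOn_weight hpos (convex_Iic 0) fun t ht' j hj => ?_)
        (h₂.monotoneOn_weight hpos (convex_Ici 0) fun t ht' j hj => ?_) (hstart l) (hb l)
        (ht l hlI' hl.ne)
      all_goals have hjl := hmono.lt_iff_lt.1 hj
      · rw [(ih j hjl (hjl.trans hl)).1 t ht']
        exact weight_O_eq_zero_or_one I j
      · rw [(ih j hjl (hjl.trans hl)).2 t ht']
        exact weight_O_eq_zero_or_one I j
  -- The mirror argument, descending from the largest index.
  have hhigh : ∀ l, I k < l → (∀ t ≤ 0, weight l (γ₁ t) = weight l (O I)) ∧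
      ∀ t, 0 ≤ t → weight l (γ₂ t) = weight l (O I) := by
    intro l
    induction l using WellFoundedGT.induction with
    | ind l ih =>
      intro hl
      have hlL' : l ≠ L k := fun e => by rw [e, Fin.lt_def] at hl; omega
      refine eq_const_of_antitoneOn_of_tendsto
        (h₁.antitoneOn_weight hpos (convex_Iic 0) fun t ht' j hj => ?_)
        (h₂.antitoneOn_weight hpos (convex_Ici 0) fun t ht' j hj => ?_) (hstart l) (hb l)
        (ht l hl.ne' hlL')
      all_goals have hjl := hmono.lt_iff_lt.1 hj
      · rw [(ih j hjl (hl.trans hjl)).1 t ht']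
        exact weight_O_eq_zero_or_one I j
      · rw [(ih j hjl (hl.trans hjl)).2 t ht']
        exact weight_O_eq_zero_or_one I j
  -- Adjacency of `L k` and `I k` enters here: no index lies strictly between them.
  rcases lt_or_ge l (L k) with h | h
  · exact hlow l h
  · refine hhigh l ?_
    have h1 : (l : ℕ) ≠ L k := fun e => hlL (Fin.ext e)
    have h2 : (l : ℕ) ≠ I k := fun e => hlI (Fin.ext e)
    rw [Fin.le_def] at h
    rw [Fin.lt_def]
    omega

theorem exists_eq_chartPoint_axis_of_mem (hpos : ∀ j, 0 < lam j) (hmono : StrictMono lam)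
    (hk : (L k : ℕ) + 1 = (I k : ℕ)) (hne : ∀ α, α ≠ k → L α = I α) {i : Free I} {j : Free L}
    (hi : (i : Fin n) = L k) (hj : (j : Fin n) = I k) {V : Gr m n}
    (hV : V ∈ Wu lam (O I) ∩ Ws lam (O L)) :
    ∃ x, x ≠ 0 ∧ V = chartPoint I (axis I k i x) := by
  obtain ⟨⟨γ₁, h₁, h10, hbot⟩, ⟨γ₂, h₂, h20, htop⟩⟩ := hV
  have hw : ∀ l, l ≠ I k → l ≠ L k → weight l V = weight l (O I) := fun l hI hL => by
    rw [← h10]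
    exact (weight_eq_of_connecting hpos hmono hk hne h₁ h₂ (h10.trans h20.symm) hbot htop
      hI hL).1 0 le_rfl
  have hrange : ∀ α, α ≠ k → weight (I α) V = 1 := fun α hα => by
    rw [hw (I α) (fun e => hα (I.injective e)) (fun e => hα (L.injective ((hne α hα).trans e))),
      weight_O_range]
  have hfree : ∀ l, (∀ α, I α ≠ l) → l ≠ L k → weight l V = 0 := fun l hl hlk => by
    rw [hw l (hl k).symm hlk]
    exact weight_O_free I ⟨l, hl⟩
  -- A zero weight would persist for all earlier times, against the limit weight 1 at `O_I`. The
  -- next claim is the forward version at `O_L`.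
  have hIV : weight (I k) V ≠ 0 := fun h => by
    have h0 : ∀ t ≤ 0, weight (I k) (γ₁ t) = 0 := fun t ht => by
      have := h₁.weight_eq_zero_of_ge hpos (h10 ▸ h) (neg_nonneg.2 ht)
      rwa [neg_neg] at this
    have h1 : Tendsto (fun t => weight (I k) (γ₁ t)) atBot (𝓝 (weight (I k) (O I))) :=
      ((continuous_weight _).tendsto _).comp hbot
    rw [weight_O_range] at h1
    refine zero_ne_one (tendsto_nhds_unique (tendsto_const_nhds.congr' ?_) h1)
    filter_upwards [eventually_le_atBot 0] with t ht
    exact (h0 t ht).symm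
  have hLV : weight (L k) V ≠ 0 := fun h => by
    have h1 : Tendsto (fun t => weight (L k) (γ₂ t)) atTop (𝓝 (weight (L k) (O L))) :=
      ((continuous_weight _).tendsto _).comp htop
    rw [weight_O_range] at h1
    refine zero_ne_one (tendsto_nhds_unique (tendsto_const_nhds.congr' ?_) h1)
    filter_upwards [eventually_ge_atTop 0] with t ht
    exact (h₂.weight_eq_zero_of_le hpos (h20 ▸ h) ht).symm
  obtain ⟨J, hJ⟩ := exists_mem_chartDomain V
  obtain ⟨Z, rfl⟩ := exists_eq_chartPoint hJ
  rcases eq_or_eq_of_mem_chartDomain hne hrange hfree hJ with rfl | rfl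
  · have hZ : Z = axis J k i (Z k i) := eq_axis_of_weight hrange fun l hl =>
      hfree l l.2 fun e => hl (Subtype.ext (e.trans hi.symm))
    refine ⟨Z k i, fun h => hLV ?_, congrArg _ hZ⟩
    rw [hZ, h, axis_zero, ← hi]
    exact weight_O_free J i
  -- In the chart of `L`, the nonzero weight of `I k` excludes the origin, so the exchange `x ↦ x⁻¹`
  -- returns to the chart of `I`.
  · have hZ : Z = axis J k j (Z k j) := by
      refine eq_axis_of_weight (fun α hα => ?_) fun l hl => ?_
      · rw [hne α hα]
        exact hrange α hα
      · refine hfree l (fun α hα => ?_) fun e => l.2 k e.symm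
        by_cases h : α = k
        · exact hl (Subtype.ext (by rw [← hα, h, hj]))
        · exact l.2 α (by rw [hne α h, hα])
    have hne0 : Z k j ≠ 0 := fun h => hIV (by
      rw [hZ, h, axis_zero, ← hj]
      exact weight_O_free J j)
    refine ⟨(Z k j)⁻¹, inv_ne_zero hne0, ?_⟩
    rw [chartPoint_axis_eq hi hj hne (inv_ne_zero hne0), inv_inv, ← hZ]

end Main

end RealGrassmann

theorem theorem2 {m n : ℕ} (lam : Fin n → ℝ) (hpos : ∀ j, 0 < lam j) (hmono : StrictMono lam)
    (I L : Fin m ↪o Fin n)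
    (hind : RealGrassmann.morseIndex lam (RealGrassmann.O I) =
      RealGrassmann.morseIndex lam (RealGrassmann.O L) + 1)
    (k : Fin m) (hk : (L k : ℕ) + 1 = (I k : ℕ)) (hne : ∀ α, α ≠ k → L α = I α) :
    RealGrassmann.Wu lam (RealGrassmann.O I) ∩ RealGrassmann.Ws lam (RealGrassmann.O L) =
      RealGrassmann.puncturedAxis I k (L k) := by
  have hlt : L k < I k := Fin.lt_def.2 (by omega)
  have hi : ∀ α, I α ≠ L k := fun α e => by
    by_cases hα : α = k
    · exact hlt.ne' (hα ▸ e)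
    · exact hα (L.injective ((hne α hα).trans e))
  have hj : ∀ α, L α ≠ I k := fun α e => by
    by_cases hα : α = k
    · exact hlt.ne (hα ▸ e)
    · exact hα (I.injective ((hne α hα).symm.trans e))
  let i : RealGrassmann.Free I := ⟨L k, hi⟩
  let j : RealGrassmann.Free L := ⟨I k, hj⟩
  ext V
  rw [show L k = (i : Fin n) from rfl, RealGrassmann.mem_puncturedAxis_iff]
  constructor
  · exact RealGrassmann.exists_eq_chartPoint_axis_of_mem hpos hmono hk hne (i := i) (j := j) rfl rfl
  · rintro ⟨x, hx, rfl⟩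
    exact RealGrassmann.chartPoint_axis_mem_Wu_inter_Ws (i := i) (j := j) hpos rfl rfl hne
      (hmono hlt) hx
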